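/- Let $\sigma(\theta)=2\sin^2\theta$ and let $\xi(r)=0$ for $r\le 0.06$, $\xi(r)=\sin^2\!\big(\tfrac{\pi}{1.2}(r-0.06)\big)$ for $0.06\le r\le 0.66$. In cylindrical coordinates $(r,\theta,z)$, $\theta$ modulo $2\pi$, consider the system $\dot r=R,\ \dot\theta=1,\ \dot z=Z$, where $$R=\begin{cases}\frac{\log(1.2)}{\pi}\sigma(\theta)\,r,&0\le\theta\le\pi,\\ -\sigma(\theta)z,&\pi\le\theta\le2\pi,\ (r\ge0.66\text{ or }z\ge0),\\ -\xi(r)\sigma(\theta)z,&\pi\le\theta\le2\pi,\ r<0.66,\ z\in[-0.26,-0.06],\\ 0,&\pi\le\theta\le2\pi,\ r<0.66,\ z<0,\ z\notin[-0.26,-0.06],\end{cases}$$ $$Z=\begin{cases}\frac{\log(0.2)}{\pi}\sigma(\theta)(z+0.2),&0\le\theta\le\pi,\\ \sigma(\theta)(r-0.66),&\pi\le\theta\le2\pi,\ (r\ge0.66\text{ or }z\ge0),\\ 0,&\pi\le\theta\le2\pi,\ r<0.66,\ z<0.\end{cases}$$ Let $Q_0=\{(x,0,z):0.05\le x\le1.05,\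 |z|\le0.5\}$ (so $\theta=0$, $r=x$ on $Q_0$). Then: 1. $Q_0$ is transversal to the vector field, and from every point of $Q_0$ there is a unique solution over $0\le t\le2\pi$ with $\theta(t)=t$. 2. For $0\le t\le\pi$ the solution from $(r_0,0,z_0)\in Q_0$ is $$r(t)=r_0\exp\!\Big[\tfrac{\log1.2}{2\pi}(2t-\sin2t)\Big],\qquad z(t)=-0.2+(z_0+0.2)\exp\!\Big[\tfrac{\log0.2}{2\pi}(2t-\sin2t)\Big];$$ in particular $r(\pi)=1.2\,r_0$, $z(\pi)=-0.2+(z_0+0.2)/5$, and at $t=\pi$ the square has become $Q_\pi=\{(x,0,z):-1.26\le x\le-0.06,\ -0.26\le z\le-0.06\}$. 3. For $\pi\le t\le2\pi$, with $\phi(t)=(t-\pi)-\sin t\cos t$: if at time $t_0\in[\pi,2\pi]$ such a solution satisfies $r\ge0.66$ or $z\ge0$, then for $t_0\le t\le2\pi$ the vector $(r-0.66,z)$ is its value at $t_0$ rotated by the angle $\phi(t)-\phi(t_0)$; if at time $t_0$ it satisfies $r<0.66$ and $z<0$, then $z$ has been constant on $[\pi,t_0]$. 4. Every point of $Q_0$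 has a unique first return to $Q_0$; the first-return map $P$ satisfies $P(Q_0)\subset\operatorname{int}Q_0$, where the interior is taken in the $xz$-plane. In the coordinates $(x,z)$, $P$ is a generalized attracting horseshoe on the square $Q=Q_0$ in the following sense, with saddle $p=(0.6,2/15)$, $m=0.66$ and keystone region $K=P(Q)\cap\{x\ge m\}$: - $P$ is a $C^1$ diffeomorphism of $Q$ onto $P(Q)\subset\operatorname{int}Q$; - each horizontal segment of $Q$ is mapped to a U-shaped curve: it splits into three consecutive pieces such that $x\circ P\le m$ is strictly increasing along the first and strictly decreasing along the last, on the middle one $x\circ P\ge m$ and $z\circ P$ is strictly monotone, and the first and last pieces are mapped to opposite sides of a horizontal line, independent of the segment, with $z\circ P$ moving from the side of the first piece to that of the last (in a direction independent of the segment); - $P$ has one or two fixed points in $Q$, all hyperbolic saddles, and $p$ is one of them; - the part of $Q$ in $x\ge p_x$ contains $K$ and the arch $P(Q)\cap\{x\ge m\}$; and $K$ contains, for some $m'\ge m$, the nonempty cap $P(Q)\cap\{x\ge m'\}$, where $P(Q)$ has points with $x>m'$; - there are $\lambda>1$ and $0<\mu<\tfrac12$ such that at every point of $Q\setminus K$ one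 has $|DP(1,0)|\ge\lambda$, and the component of $DP(0,1)$ normal to $DP(1,0)$ has length at most $\mu$; - an arc through $p$, the graph $x=g(z)$, $z_1\le z\le z_2$, of a continuous function, with $z_1<p_z<z_2$, contained in $W^s(p)\cap P(Q)$ and with both endpoints on the boundary of $P(Q)$, lies strictly to the right of $P(K)$: every point of $P(K)$ has smaller $x$-coordinate than every point of the arc. Here $W^s(p)=\{q\in Q: P^n(q)\to p\}$. 5. The image $P(Q_0)$ is the horseshoe obtained by the half-turn $(x,z)\mapsto(1.1-x,-z)$ about the centre of $Q_0$ from $$\{x\le0.44,\ 0.06^2\le(x-0.44)^2+z^2\le0.26^2\}\ \cup\ \{0.44\le x\le1.04,\ 0.06\le|z|\le0.26\}.$$ -/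

import Mathlib

open Set Filter Topology

noncomputable section

/-! ### The piecewise system in cylindrical coordinates `(r, θ, z)` -/

/-- `σ(θ) = 2 sin² θ`. -/
def sigma (θ : ℝ) : ℝ := 2 * Real.sin θ ^ 2

/-- The cut-off `ξ(r)`; it is only used for `r < 0.66`. -/
def xi (r : ℝ) : ℝ :=
  if r ≤ 0.06 then 0 else Real.sin (Real.pi / 1.2 * (r - 0.06)) ^ 2

open Classical in
/-- The radial component for an angle `0 ≤ θ ≤ 2π`. -/
def fieldR (r θ z : ℝ) : ℝ :=
  if θ ≤ Real.pi then Real.log 1.2 * sigma θ * r / Real.pi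
  else if 0.66 ≤ r ∨ 0 ≤ z then -(sigma θ * z)
  else if -0.26 ≤ z ∧ z ≤ -0.06 then -(xi r * sigma θ * z)
  else 0

open Classical in
/-- The vertical component for an angle `0 ≤ θ ≤ 2π`. -/
def fieldZ (r θ z : ℝ) : ℝ :=
  if θ ≤ Real.pi then Real.log 0.2 * sigma θ * (z + 0.2) / Real.pi
  else if 0.66 ≤ r ∨ 0 ≤ z then sigma θ * (r - 0.66)
  else 0

/-- The representative in `[0, 2π)` of the angle `θ`. -/
def angleRep (θ : ℝ) : ℝ := toIcoMod Real.two_pi_pos 0 θ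

/-- The vector field `(ṙ, θ̇, ż) = (R, 1, Z)`, with `θ` an angle modulo `2π`.
At the angles `0, π` modulo `2π`, where two branches meet, `σ` vanishes and the branches agree. -/
def cylField (c : ℝ × ℝ × ℝ) : ℝ × ℝ × ℝ :=
  (fieldR c.1 (angleRep c.2.1) c.2.2, 1, fieldZ c.1 (angleRep c.2.1) c.2.2)

/-- From cylindrical coordinates `(r, θ, z)` to Cartesian coordinates `(x, y, z)`. -/
def toCart (c : ℝ × ℝ × ℝ) : ℝ × ℝ × ℝ :=
  (c.1 * Real.cos c.2.1, c.1 * Real.sin c.2.1, c.2.2)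

/-- The field in Cartesian components at the point with cylindrical coordinates `c`. -/
def cartVelocity (c : ℝ × ℝ × ℝ) : ℝ × ℝ × ℝ :=
  ((cylField c).1 * Real.cos c.2.1 - c.1 * (cylField c).2.1 * Real.sin c.2.1,
   (cylField c).1 * Real.sin c.2.1 + c.1 * (cylField c).2.1 * Real.cos c.2.1,
   (cylField c).2.2)

/-- `γ` is a (classical) solution on the time interval `[0, T]`. -/
def IsSolutionOn (γ : ℝ → ℝ × ℝ × ℝ) (T : ℝ) : Prop :=
  ∀ t ∈ Icc 0 T, HasDerivWithinAt γ (cylField (γ t)) (Icc 0 T) t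

/-! ### The transversal and its first-return map -/

/-- A coordinate rectangle in the plane. -/
def rect (a b c d : ℝ) : Set (ℝ × ℝ) := Icc a b ×ˢ Icc c d

/-- The square `Q₀` in the coordinates `(x, z)` of the plane `y = 0`. -/
def Q0 : Set (ℝ × ℝ) := rect 0.05 1.05 (-0.5) 0.5

/-- The point of the plane `y = 0` of `ℝ³` with coordinates `(x, z)`. -/
def toSpace (q : ℝ × ℝ) : ℝ × ℝ × ℝ := (q.1, 0, q.2)

/-- `γ` solves the system on `[0, T]` and starts at the point `q` of the half-plane `θ = 0`. -/
def IsOrbitFrom (q : ℝ × ℝ) (γ : ℝ → ℝ × ℝ × ℝ) (T : ℝ) : Prop :=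
  γ 0 = (q.1, 0, q.2) ∧ IsSolutionOn γ T

/-- `q'` is the first point of `Q₀` that an orbit from `q` meets after time `0`. -/
def IsFirstReturn (q q' : ℝ × ℝ) : Prop :=
  ∃ (γ : ℝ → ℝ × ℝ × ℝ) (T : ℝ), 0 < T ∧ IsOrbitFrom q γ T ∧
    q' ∈ Q0 ∧ toCart (γ T) = toSpace q' ∧ ∀ t ∈ Ioo 0 T, toCart (γ t) ∉ toSpace '' Q0

/-- `P` is the first-return map of `Q₀`: every point of `Q₀` has exactly one first return, and it
is given by `P`. The values of `P` off `Q₀` are irrelevant. -/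
def IsPoincareMap (P : ℝ × ℝ → ℝ × ℝ) : Prop :=
  ∀ q ∈ Q0, ∀ q', IsFirstReturn q q' ↔ q' = P q

/-- The angle `φ(t) = (t - π) - sin t cos t` of the folding rotation at time `t`. -/
def foldAngle (t : ℝ) : ℝ := (t - Real.pi) - Real.sin t * Real.cos t

/-! ### Generalized attracting horseshoes on a rectangle -/

/-- The Euclidean length of a plane vector. -/
def eucl (v : ℝ × ℝ) : ℝ := Real.sqrt (v.1 ^ 2 + v.2 ^ 2)

/-- The determinant of two plane vectors. -/
def det2 (v w : ℝ × ℝ) : ℝ := v.1 * w.2 - v.2 * w.1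

/-- `F` restricts to a `C¹` diffeomorphism of `Q` onto `F(Q)`. -/
def IsC1DiffeoOn (F : ℝ × ℝ → ℝ × ℝ) (Q : Set (ℝ × ℝ)) : Prop :=
  ContDiffOn ℝ 1 F Q ∧ ∃ G : ℝ × ℝ → ℝ × ℝ, ContDiffOn ℝ 1 G (F '' Q) ∧ ∀ q ∈ Q, G (F q) = q

/-- The linear map `L` of the plane is a hyperbolic saddle. -/
def IsSaddle (L : ℝ × ℝ →L[ℝ] ℝ × ℝ) : Prop :=
  ∃ (s u : ℝ) (v w : ℝ × ℝ), v ≠ 0 ∧ w ≠ 0 ∧ L v = s • v ∧ L w = u • w ∧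
    0 < |s| ∧ |s| < 1 ∧ 1 < |u|

/-- The stable set in `Q` of the fixed point `p` of `F : Q → Q`. -/
def stableSet (F : ℝ × ℝ → ℝ × ℝ) (Q : Set (ℝ × ℝ)) (p : ℝ × ℝ) : Set (ℝ × ℝ) :=
  {q ∈ Q | Tendsto (fun n : ℕ => F^[n] q) atTop (𝓝 p)}

/-- `F` folds the rectangle `[a, b] × [c, d]` into a horseshoe with its arch in `x ≥ m`:
each horizontal segment is mapped to a U-shaped curve, which runs to the right along one leg up to
the line `x = m`, turns around (upwards if `ε = 1`, downwards if `ε = -1`) in `x ≥ m`, and runs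
back to the left along the other leg; the two legs lie on different sides of a line `y = e`. -/
def FoldsToHorseshoe (F : ℝ × ℝ → ℝ × ℝ) (a b c d m : ℝ) : Prop :=
  ∃ ε e : ℝ, (ε = 1 ∨ ε = -1) ∧ ∀ z ∈ Icc c d, ∃ α β : ℝ, a < α ∧ α < β ∧ β < b ∧
    StrictMonoOn (fun x => (F (x, z)).1) (Icc a α) ∧
    (∀ x ∈ Icc a α, (F (x, z)).1 ≤ m ∧ ε * ((F (x, z)).2 - e) < 0) ∧
    StrictMonoOn (fun x => ε * (F (x, z)).2) (Icc α β) ∧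
    (∀ x ∈ Icc α β, m ≤ (F (x, z)).1) ∧
    StrictAntiOn (fun x => (F (x, z)).1) (Icc β b) ∧
    (∀ x ∈ Icc β b, (F (x, z)).1 ≤ m ∧ 0 < ε * ((F (x, z)).2 - e))

/-- `F` is a (planar, `C¹`) generalized attracting horseshoe on the rectangle
`Q = [a, b] × [c, d]`, with distinguished saddle `p`, arch `F(Q) ∩ {x ≥ m}` and keystone
region `K`. -/
structure IsGAH (F : ℝ × ℝ → ℝ × ℝ) (a b c d m : ℝ) (p : ℝ × ℝ) (K : Set (ℝ × ℝ)) : Prop where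
  /-- `F` is a `C¹` diffeomorphism onto its image. -/
  diffeo : IsC1DiffeoOn F (rect a b c d)
  /-- `Q` is a trapping region. -/
  trapping : MapsTo F (rect a b c d) (interior (rect a b c d))
  /-- The image is a horseshoe. -/
  horseshoe : FoldsToHorseshoe F a b c d m
  /-- There are one or two fixed points. -/
  fixed_card : {q ∈ rect a b c d | F q = q}.ncard = 1 ∨ {q ∈ rect a b c d | F q = q}.ncard = 2
  /-- All fixed points are saddles. -/
  fixed_saddle : ∀ q ∈ rect a b c d, F q = q → IsSaddle (fderivWithin ℝ F (rect a b c d) q)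
  /-- `p` is a fixed point. -/
  p_fixed : p ∈ rect a b c d ∧ F p = p
  /-- The subrectangle `S = [p.1, b] × [c, d]` contains the arch. -/
  arch_right : F '' rect a b c d ∩ {q | m ≤ q.1} ⊆ rect p.1 b c d
  /-- The subrectangle `S` contains the keystone region. -/
  keystone_right : K ⊆ rect p.1 b c d
  /-- The keystone region contains a portion of the arch, namely its cap beyond some line
  `x = m'`. -/
  keystone_arch : ∃ m', m ≤ m' ∧ (∃ q ∈ F '' rect a b c d, m' < q.1) ∧
    F '' rect a b c d ∩ {q | m' ≤ q.1} ⊆ K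
  /-- Off `K`, the map expands uniformly along the length of the horseshoe (the direction of the
  images of horizontal segments) and contracts transversally to it, by a factor uniformly less
  than `1/2`; the transverse factor is the length of the component of `DF(0,1)` normal to
  `DF(1,0)`. -/
  expansion : ∃ lam mu : ℝ, 1 < lam ∧ 0 < mu ∧ mu < 1 / 2 ∧ ∀ q ∈ rect a b c d \ K,
    lam ≤ eucl (fderivWithin ℝ F (rect a b c d) q (1, 0)) ∧
    |det2 (fderivWithin ℝ F (rect a b c d) q (1, 0)) (fderivWithin ℝ F (rect a b c d) q (0, 1))|
      ≤ mu * eucl (fderivWithin ℝ F (rect a b c d) q (1, 0))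
  /-- `F(K)` lies to the left of `p` and of the portion of the stable manifold of `p` in `F(Q)`
  that contains `p`; that portion is an arc `x = g(y)`, `y₁ ≤ y ≤ y₂`, which crosses `F(Q)` from
  boundary to boundary. -/
  keystone_left : ∃ (g : ℝ → ℝ) (y₁ y₂ : ℝ), ContinuousOn g (Icc y₁ y₂) ∧
    p.2 ∈ Ioo y₁ y₂ ∧ g p.2 = p.1 ∧
    (∀ y ∈ Icc y₁ y₂, (g y, y) ∈ stableSet F (rect a b c d) p ∩ F '' rect a b c d) ∧
    (g y₁, y₁) ∈ frontier (F '' rect a b c d) ∧ (g y₂, y₂) ∈ frontier (F '' rect a b c d) ∧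
    ∀ q ∈ K, ∀ y ∈ Icc y₁ y₂, (F q).1 < g y

/-- The half-turn about the centre `(0.55, 0)` of `Q₀`. -/
def halfTurn (q : ℝ × ℝ) : ℝ × ℝ := (1.1 - q.1, -q.2)

/-- The horseshoe with arch the left half of the annulus of radii `ρ₁ < ρ₂` about `(k, 0)` and
with two straight horizontal legs of length `l` pointing to the right. -/
def horseshoeSet (k l ρ₁ ρ₂ : ℝ) : Set (ℝ × ℝ) :=
  {q | q.1 ≤ k ∧ ρ₁ ^ 2 ≤ (q.1 - k) ^ 2 + q.2 ^ 2 ∧ (q.1 - k) ^ 2 + q.2 ^ 2 ≤ ρ₂ ^ 2} ∪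
    {q | k ≤ q.1 ∧ q.1 ≤ k + l ∧ ρ₁ ≤ |q.2| ∧ |q.2| ≤ ρ₂}

end

/-! The system is integrated in closed form. The first half-turn is linear and takes `(x, z)` to
`(1.2 x, -c)`, with `c = depth z` in `[0.06, 0.26]`. On the second half-turn the field is `σ(t)`
times an autonomous planar field, and `foldAngle` has derivative `σ`, so it replaces time by a
rotation angle `φ` running from `0` to `π`.

Planar orbits starting at height `-c` are of three kinds. At `x = 0.05` the cut-off vanishes and the
point rests. For `0.05 < x ≤ 0.55` the point slides along the leg `z = -c` with `dr/dφ = c ξ(r)`;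
since `ξ` is a squared sine, `arctan` solves this equation, and `r = 0.66` is reached at the angle
`arrival x / c`, after which the point rotates about `(0.66, 0)`. For `x > 0.55` it rotates from the
start (`hasDerivAt_foldCurve`).

The folding field is discontinuous, so Picard's theorem does not apply to it directly. Every point
of an explicit orbit before its end is nevertheless forward regular (`isFoldRegular_foldCurve`):
solutions from it follow, for a short time, a common Lipschitz field. Continuous induction gives
uniqueness (`IsOrbitFrom.eqOn`). As the angle equals time and `r > 0`, the first return occurs
exactly at `2π`.

The return map depends on `x` only through `T = arrival x` and on `z` only through `c`. With `T`
continued with slope `-1.2` past `x = 0.55`, it is the upper leg for `T ≤ 0`, a half-circle of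
radius `c` for `0 ≤ T ≤ πc`, and the lower leg beyond. Along the upper leg and the arch `T` is arc
length. The normal direction is always contracted by `1/5`; the tangential expansion is at least
`1.2`, because the slowing on the lower leg never outweighs the steepness of the cotangent
(`returnMap_frame`, `le_eucl_fderiv_returnMap`). Since `T` is infinite at `x = 0.05`, a second
formula, `lowerLeg`, carries the map past that edge, and the `C¹` inverse comes from the inverse
function theorem on an open neighbourhood of the square.

On `x ≥ 0.55` the map is `(1.32 - 1.2 x, 0.16 - z / 5)`. This yields the saddle `(0.6, 2/15)`, its
vertical stable segment, and the fact that the arch lands to the left of that segment. -/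

/-! ### Normal forms of the field -/

open Classical in
/-- The radial component of the folding field, per unit of rotation angle. -/
noncomputable def foldR (r z : ℝ) : ℝ :=
  if 0.66 ≤ r ∨ 0 ≤ z then -z else if -0.26 ≤ z ∧ z ≤ -0.06 then -(xi r * z) else 0

open Classical in
/-- The vertical component of the folding field, per unit of rotation angle. -/
noncomputable def foldZ (r z : ℝ) : ℝ :=
  if 0.66 ≤ r ∨ 0 ≤ z then r - 0.66 else 0

theorem sigma_nonneg (t : ℝ) : 0 ≤ sigma t := by unfold sigma; positivity

theorem sigma_le_two (t : ℝ) : sigma t ≤ 2 := by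
  unfold sigma; linarith [Real.sin_sq_le_one t]

theorem angleRep_of_mem {t : ℝ} (ht : t ∈ Ico 0 (2 * Real.pi)) : angleRep t = t :=
  (toIcoMod_eq_self Real.two_pi_pos).2 (by simpa using ht)

theorem angleRep_two_pi : angleRep (2 * Real.pi) = 0 := by
  have := toIcoMod_add_right Real.two_pi_pos 0 0
  rw [zero_add] at this
  unfold angleRep
  rw [this]
  exact (toIcoMod_eq_self Real.two_pi_pos).2 (by simp [Real.pi_pos])

theorem cylField_stretch {t : ℝ} (h0 : 0 ≤ t) (h1 : t ≤ Real.pi) (r z : ℝ) :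
    cylField (r, t, z) = (Real.log 1.2 * sigma t * r / Real.pi, 1,
      Real.log 0.2 * sigma t * (z + 0.2) / Real.pi) := by
  have hp := Real.pi_pos
  simp only [cylField, angleRep_of_mem (⟨h0, by linarith⟩ : t ∈ Ico 0 (2 * Real.pi)), fieldR,
    fieldZ, if_pos h1]

/-- The closed interval is allowed because `σ` vanishes at both ends: `π` belongs to the stretching
branch, and `2π` is represented by the angle `0`, again in that branch. -/
theorem cylField_fold {t : ℝ} (h0 : Real.pi ≤ t) (h1 : t ≤ 2 * Real.pi) (r z : ℝ) :
    cylField (r, t, z) = (sigma t * foldR r z, 1, sigma t * foldZ r z) := by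
  have hp := Real.pi_pos
  rcases h0.eq_or_lt with rfl | h0
  · rw [cylField_stretch hp.le le_rfl]
    simp [sigma]
  rcases h1.eq_or_lt with rfl | h1
  · simp only [cylField, angleRep_two_pi, fieldR, fieldZ, if_pos hp.le]
    simp [sigma]
  · simp only [cylField, angleRep_of_mem (⟨by linarith, h1⟩ : t ∈ Ico 0 (2 * Real.pi)), fieldR,
      fieldZ, if_neg (not_le.2 h0), foldR, foldZ]
    ext
    · simp only
      split_ifs <;> ring
    · rfl
    · simp only
      split_ifs <;> ring

theorem foldR_of_mem {r z : ℝ} (h : 0.66 ≤ r ∨ 0 ≤ z) : foldR r z = -z := if_pos h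

theorem foldZ_of_mem {r z : ℝ} (h : 0.66 ≤ r ∨ 0 ≤ z) : foldZ r z = r - 0.66 := if_pos h

theorem foldR_of_leg {r z : ℝ} (hr : r < 0.66) (hz : z ∈ Icc (-0.26 : ℝ) (-0.06)) :
    foldR r z = -(xi r * z) := by
  have h2 : ¬ (0.66 ≤ r ∨ 0 ≤ z) := by
    push Not; exact ⟨hr, by linarith [hz.2]⟩
  rw [foldR, if_neg h2, if_pos ⟨hz.1, hz.2⟩]

theorem foldZ_of_neg {r z : ℝ} (hr : r < 0.66) (hz : z < 0) : foldZ r z = 0 :=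
  if_neg (by push Not; exact ⟨hr, hz⟩)

theorem xi_nonneg (r : ℝ) : 0 ≤ xi r := by
  unfold xi; split_ifs <;> positivity

theorem foldR_nonneg {r z : ℝ} (hz : z < 0) : 0 ≤ foldR r z := by
  unfold foldR
  split_ifs
  · linarith
  · nlinarith [xi_nonneg r]
  · exact le_rfl

/-- Truncating the argument instead of the value exhibits `ξ` as a composition of Lipschitz maps on
the whole line. -/
theorem xi_eq (r : ℝ) : xi r = Real.sin (Real.pi / 1.2 * max (r - 0.06) 0) ^ 2 := by
  unfold xi
  split_ifs with h
  · rw [max_eq_right (by linarith)]; simp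
  · rw [max_eq_left (by linarith)]

theorem abs_sin_sq_sub_le (a b : ℝ) : |Real.sin a ^ 2 - Real.sin b ^ 2| ≤ |a - b| := by
  have h : Real.sin a ^ 2 - Real.sin b ^ 2 = Real.sin (a + b) * Real.sin (a - b) := by
    rw [Real.sin_add, Real.sin_sub]
    nlinarith [Real.sin_sq_add_cos_sq a, Real.sin_sq_add_cos_sq b]
  rw [h, abs_mul]
  calc |Real.sin (a + b)| * |Real.sin (a - b)| ≤ 1 * |a - b| :=
        mul_le_mul (Real.abs_sin_le_one _) Real.abs_sin_le_abs (abs_nonneg _) zero_le_one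
    _ = _ := one_mul _

theorem abs_xi_sub_le (r s : ℝ) : |xi r - xi s| ≤ 3 * |r - s| := by
  rw [xi_eq, xi_eq]
  refine (abs_sin_sq_sub_le _ _).trans ?_
  rw [← mul_sub, abs_mul, abs_of_pos (by positivity)]
  have h1 : |max (r - 0.06) 0 - max (s - 0.06) 0| ≤ |r - s| := by
    refine (abs_max_sub_max_le_abs _ _ _).trans (le_of_eq ?_)
    congr 1; ring
  have h2 : Real.pi / 1.2 ≤ 3 := by
    rw [div_le_iff₀ (by norm_num)]; linarith [Real.pi_lt_d2]
  exact mul_le_mul h2 h1 (abs_nonneg _) (by norm_num)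

/-! ### Uniqueness of orbits -/

theorem lipschitzWith_mk {a b : ℝ × ℝ × ℝ → ℝ} {K : NNReal}
    (ha : ∀ p q, |a p - a q| ≤ K * dist p q) (hb : ∀ p q, |b p - b q| ≤ K * dist p q) :
    LipschitzWith K fun p => (a p, (1 : ℝ), b p) := by
  refine LipschitzWith.of_dist_le_mul fun p q => ?_
  rw [Prod.dist_eq, Prod.dist_eq, Real.dist_eq, Real.dist_eq]
  refine max_le (ha p q) (max_le ?_ (hb p q))
  simp only [sub_self, abs_zero]
  positivity

theorem abs_fst_sub_le (p q : ℝ × ℝ × ℝ) : |p.1 - q.1| ≤ dist p q := by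
  rw [Prod.dist_eq, Real.dist_eq]; exact le_max_left _ _

theorem abs_height_sub_le (p q : ℝ × ℝ × ℝ) : |p.2.2 - q.2.2| ≤ dist p q := by
  rw [Prod.dist_eq, Prod.dist_eq, Real.dist_eq p.2.2]
  exact (le_max_right _ _).trans (le_max_right _ _)

theorem IsSolutionOn.continuousOn {γ : ℝ → ℝ × ℝ × ℝ} {T : ℝ} (h : IsSolutionOn γ T) :
    ContinuousOn γ (Icc 0 T) := fun t ht => (h t ht).continuousWithinAt

theorem IsSolutionOn.hasDerivWithinAt_Ici {γ : ℝ → ℝ × ℝ × ℝ} {T t : ℝ} (h : IsSolutionOn γ T)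
    (ht : t ∈ Ico 0 T) : HasDerivWithinAt γ (cylField (γ t)) (Ici t) t :=
  (h t ⟨ht.1, ht.2.le⟩).mono_of_mem_nhdsWithin
    (mem_of_superset (Icc_mem_nhdsGE ht.2) (Icc_subset_Icc_left ht.1))

theorem IsSolutionOn.mono {γ : ℝ → ℝ × ℝ × ℝ} {S T : ℝ} (h : IsSolutionOn γ T) (hS : S ≤ T) :
    IsSolutionOn γ S := fun t ht =>
  (h t ⟨ht.1, ht.2.trans hS⟩).mono (Icc_subset_Icc_right hS)

theorem IsOrbitFrom.mono {q : ℝ × ℝ} {γ : ℝ → ℝ × ℝ × ℝ} {S T : ℝ} (h : IsOrbitFrom q γ T)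
    (hS : S ≤ T) : IsOrbitFrom q γ S := ⟨h.1, h.2.mono hS⟩

theorem IsOrbitFrom.angle_eq {q : ℝ × ℝ} {γ : ℝ → ℝ × ℝ × ℝ} {T : ℝ} (h : IsOrbitFrom q γ T)
    {t : ℝ} (ht : t ∈ Icc 0 T) : (γ t).2.1 = t := by
  have hd : ∀ s ∈ Ico 0 T, HasDerivWithinAt (fun s => (γ s).2.1 - s) 0 (Ici s) s := by
    intro s hs
    have h1 : HasDerivWithinAt (fun s => (γ s).2.1) (cylField (γ s)).2.1 (Ici s) s :=
      (h.2.hasDerivWithinAt_Ici hs).snd.fst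
    have h2 : HasDerivWithinAt (fun s => (γ s).2.1 - s) ((cylField (γ s)).2.1 - 1) (Ici s) s :=
      h1.sub (hasDerivWithinAt_id s (Ici s))
    simpa [cylField] using h2
  have hc : ContinuousOn (fun s => (γ s).2.1 - s) (Icc 0 T) :=
    (h.2.continuousOn.snd.fst).sub continuousOn_id
  have := constant_of_has_deriv_right_zero hc hd t ht
  simp only [h.1, sub_zero] at this
  linarith

/-- The field need not be Lipschitz near the point: it is enough that it coincides with a Lipschitz
field `v` along the two given curves. -/
theorem eventuallyEq_of_lipschitz {δ γ : ℝ → ℝ × ℝ × ℝ} {T t₀ : ℝ} (hδ : IsSolutionOn δ T)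
    (hγ : IsSolutionOn γ T) (ht₀ : t₀ ∈ Ico 0 T) (heq : δ t₀ = γ t₀)
    {v : ℝ → ℝ × ℝ × ℝ → ℝ × ℝ × ℝ} {K : NNReal} (hv : ∀ t, LipschitzWith K (v t))
    (hδv : ∀ᶠ t in 𝓝[≥] t₀, cylField (δ t) = v t (δ t))
    (hγv : ∀ᶠ t in 𝓝[≥] t₀, cylField (γ t) = v t (γ t)) : ∀ᶠ t in 𝓝[>] t₀, δ t = γ t := by
  obtain ⟨b, hb, hbs⟩ := mem_nhdsGE_iff_exists_Ico_subset.1 (hδv.and hγv)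
  set e := min b T
  have he : t₀ < e := lt_min hb ht₀.2
  have hsub : Icc t₀ e ⊆ Icc 0 T := Icc_subset_Icc ht₀.1 (min_le_right _ _)
  have hmem : ∀ t ∈ Ico t₀ e, t ∈ Ico 0 T := fun t ht =>
    ⟨ht₀.1.trans ht.1, ht.2.trans_le (min_le_right _ _)⟩
  have hbs' : ∀ t ∈ Ico t₀ e, cylField (δ t) = v t (δ t) ∧ cylField (γ t) = v t (γ t) :=
    fun t ht => hbs ⟨ht.1, ht.2.trans_le (min_le_left _ _)⟩
  have key : EqOn δ γ (Icc t₀ e) :=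
    ODE_solution_unique_of_mem_Icc_right (v := v) (s := fun _ => univ) (K := K)
      (fun t _ => (hv t).lipschitzOnWith) (hδ.continuousOn.mono hsub)
      (fun t ht => (hbs' t ht).1 ▸ hδ.hasDerivWithinAt_Ici (hmem t ht)) (fun _ _ => mem_univ _)
      (hγ.continuousOn.mono hsub)
      (fun t ht => (hbs' t ht).2 ▸ hγ.hasDerivWithinAt_Ici (hmem t ht)) (fun _ _ => mem_univ _)
      heq
  filter_upwards [Ioc_mem_nhdsGT he] with t ht using key ⟨ht.1.le, ht.2⟩

/-- Points of the folding half-turn from which solutions are unique in forward time. -/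
def IsFoldRegular (r z : ℝ) : Prop :=
  0.66 < r ∨ 0 < z ∨ (0.66 ≤ r ∧ z < 0) ∨ (r < 0.66 ∧ z ∈ Icc (-0.26 : ℝ) (-0.06))

section
variable {q : ℝ × ℝ} {δ γ : ℝ → ℝ × ℝ × ℝ} {T t₀ : ℝ}

theorem IsOrbitFrom.eta (h : IsOrbitFrom q γ T) {t : ℝ} (ht : t ∈ Icc 0 T) :
    γ t = ((γ t).1, t, (γ t).2.2) := by
  ext
  · rfl
  · exact h.angle_eq ht
  · rfl

theorem IsOrbitFrom.tendsto (h : IsOrbitFrom q γ T) (ht : t₀ ∈ Ico 0 T) :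
    Tendsto γ (𝓝[≥] t₀) (𝓝 (γ t₀)) :=
  (h.2.hasDerivWithinAt_Ici ht).continuousWithinAt

theorem IsOrbitFrom.eventually_stretch (h : IsOrbitFrom q γ T) (ht : t₀ ∈ Ico 0 T)
    (ht' : t₀ < Real.pi) :
    ∀ᶠ t in 𝓝[≥] t₀, cylField (γ t) = (Real.log 1.2 * sigma t * (γ t).1 / Real.pi, 1,
      Real.log 0.2 * sigma t * ((γ t).2.2 + 0.2) / Real.pi) := by
  filter_upwards [Icc_mem_nhdsGE ht.2, Icc_mem_nhdsGE ht'] with t h1 h2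
  have h3 : t ∈ Icc 0 T := ⟨ht.1.trans h1.1, h1.2⟩
  have h4 := h.eta h3
  rw [h4]
  exact cylField_stretch h3.1 h2.2 _ _

theorem IsOrbitFrom.cylField_fold (h : IsOrbitFrom q γ T) (hT : T ≤ 2 * Real.pi)
    {t : ℝ} (ht : t ∈ Icc 0 T) (ht' : Real.pi ≤ t) :
    cylField (γ t) =
      (sigma t * foldR (γ t).1 (γ t).2.2, 1, sigma t * foldZ (γ t).1 (γ t).2.2) := by
  have h4 := h.eta ht
  rw [h4]
  exact _root_.cylField_fold ht' (ht.2.trans hT) _ _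

theorem IsOrbitFrom.eventually_rotate (h : IsOrbitFrom q γ T) (hT : T ≤ 2 * Real.pi)
    (ht : t₀ ∈ Ico 0 T) (ht' : Real.pi ≤ t₀)
    (hD : ∀ᶠ t in 𝓝[≥] t₀, 0.66 ≤ (γ t).1 ∨ 0 ≤ (γ t).2.2) :
    ∀ᶠ t in 𝓝[≥] t₀,
      cylField (γ t) = (-(sigma t * (γ t).2.2), 1, sigma t * ((γ t).1 - 0.66)) := by
  filter_upwards [Icc_mem_nhdsGE ht.2, hD] with t h1 h2
  rw [h.cylField_fold hT ⟨ht.1.trans h1.1, h1.2⟩ (ht'.trans h1.1), foldR_of_mem h2,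
    foldZ_of_mem h2, mul_neg]

/-- The delicate case is the edge `r = 0.66`, `z < 0`, where the field jumps. While `z < 0` the
radial component is nonnegative, so `r` cannot fall back below `0.66`. -/
theorem IsOrbitFrom.eventually_outer (h : IsOrbitFrom q γ T) (hT : T ≤ 2 * Real.pi)
    (ht : t₀ ∈ Ico 0 T) (ht' : Real.pi ≤ t₀)
    (hp : 0.66 < (γ t₀).1 ∨ 0 < (γ t₀).2.2 ∨ (0.66 ≤ (γ t₀).1 ∧ (γ t₀).2.2 < 0)) :
    ∀ᶠ t in 𝓝[≥] t₀, 0.66 ≤ (γ t).1 ∨ 0 ≤ (γ t).2.2 := by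
  have c1 : Tendsto (fun t => (γ t).1) (𝓝[≥] t₀) (𝓝 (γ t₀).1) :=
    (continuous_fst.tendsto _).comp (h.tendsto ht)
  have c2 : Tendsto (fun t => (γ t).2.2) (𝓝[≥] t₀) (𝓝 (γ t₀).2.2) :=
    ((continuous_snd.comp continuous_snd).tendsto _).comp (h.tendsto ht)
  rcases hp with hp | hp | ⟨hr, hz⟩
  · filter_upwards [c1.eventually_const_lt hp] with t h1 using Or.inl h1.le
  · filter_upwards [c2.eventually_const_lt hp] with t h1 using Or.inr h1.le
  · obtain ⟨b, hb, hbs⟩ := mem_nhdsGE_iff_exists_Ico_subset.1 (c2.eventually_lt_const hz)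
    set e := min b T
    have he : t₀ < e := lt_min hb ht.2
    have hmem : ∀ t ∈ Ico t₀ e, t ∈ Icc 0 T := fun t ht1 =>
      ⟨ht.1.trans ht1.1, ht1.2.le.trans (min_le_right _ _)⟩
    have hmono : MonotoneOn (fun t => (γ t).1) (Ico t₀ e) := by
      refine monotoneOn_of_hasDerivWithinAt_nonneg (convex_Ico _ _)
        (f' := fun t => (cylField (γ t)).1) (h.2.continuousOn.fst.mono hmem) ?_ ?_
      · intro t ht1
        exact ((h.2 t (hmem t (interior_subset ht1))).mono
          (interior_subset.trans hmem)).fst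
      · intro t ht1
        have ht2 := interior_subset ht1
        rw [h.cylField_fold hT (hmem t ht2) (ht'.trans ht2.1)]
        exact mul_nonneg (sigma_nonneg t)
          (foldR_nonneg (hbs ⟨ht2.1, ht2.2.trans_le (min_le_left _ _)⟩))
    filter_upwards [Ico_mem_nhdsGE he] with t h1
    exact Or.inl (hr.trans (hmono ⟨le_rfl, he⟩ h1 h1.1))

/-- The field jumps at `z = -0.26` and `z = -0.06`. Below the plane and left of `r = 0.66` the
height is stationary, so it can be frozen at its initial value, leaving a Lipschitz field in `r`
alone. -/
theorem IsOrbitFrom.eventually_leg (h : IsOrbitFrom q γ T) (hT : T ≤ 2 * Real.pi)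
    (ht : t₀ ∈ Ico 0 T) (ht' : Real.pi ≤ t₀) (hr : (γ t₀).1 < 0.66)
    (hz : (γ t₀).2.2 ∈ Icc (-0.26 : ℝ) (-0.06)) :
    ∀ᶠ t in 𝓝[≥] t₀,
      cylField (γ t) = (-(sigma t * (xi (γ t).1 * (γ t₀).2.2)), 1, 0) := by
  have c1 : Tendsto (fun t => (γ t).1) (𝓝[≥] t₀) (𝓝 (γ t₀).1) :=
    (continuous_fst.tendsto _).comp (h.tendsto ht)
  have c2 : Tendsto (fun t => (γ t).2.2) (𝓝[≥] t₀) (𝓝 (γ t₀).2.2) :=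
    ((continuous_snd.comp continuous_snd).tendsto _).comp (h.tendsto ht)
  have hz' : (γ t₀).2.2 < 0 := by linarith [hz.2]
  obtain ⟨b, hb, hbs⟩ := mem_nhdsGE_iff_exists_Icc_subset.1
    ((c1.eventually_lt_const hr).and (c2.eventually_lt_const hz'))
  set e := min b T
  have he : t₀ < e := lt_min hb ht.2
  have hmem : ∀ t ∈ Icc t₀ e, t ∈ Icc 0 T := fun t ht1 =>
    ⟨ht.1.trans ht1.1, ht1.2.trans (min_le_right _ _)⟩
  have hbs' : ∀ t ∈ Icc t₀ e, (γ t).1 < 0.66 ∧ (γ t).2.2 < 0 := fun t ht1 =>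
    hbs ⟨ht1.1, ht1.2.trans (min_le_left _ _)⟩
  have hconst : ∀ t ∈ Icc t₀ e, (γ t).2.2 = (γ t₀).2.2 := by
    refine constant_of_has_deriv_right_zero (h.2.continuousOn.snd.snd.mono hmem) ?_
    intro t ht1
    have ht2 := hmem t (Ico_subset_Icc_self ht1)
    have h2 : HasDerivWithinAt (fun t => (γ t).2.2) (cylField (γ t)).2.2 (Ici t) t :=
      (h.2.hasDerivWithinAt_Ici ⟨ht2.1, ht1.2.trans_le (min_le_right _ _)⟩).snd.snd
    have h3 := hbs' t (Ico_subset_Icc_self ht1)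
    simpa [h.cylField_fold hT ht2 (ht'.trans ht1.1), foldZ_of_neg h3.1 h3.2] using h2
  filter_upwards [Icc_mem_nhdsGE he] with t h1
  have h3 := hbs' t h1
  rw [h.cylField_fold hT (hmem t h1) (ht'.trans h1.1), foldZ_of_neg h3.1 h3.2,
    foldR_of_leg h3.1 (by rw [hconst t h1]; exact hz), hconst t h1, mul_zero, mul_neg]

/-! ### Lipschitz bounds for the three smooth regimes, and uniqueness -/

theorem lipschitzWith_stretch (t : ℝ) : LipschitzWith 3 fun p : ℝ × ℝ × ℝ =>
    (Real.log 1.2 * sigma t * p.1 / Real.pi, (1 : ℝ),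
      Real.log 0.2 * sigma t * (p.2.2 + 0.2) / Real.pi) := by
  have hp := Real.pi_gt_three
  have hs0 := sigma_nonneg t
  have hs2 := sigma_le_two t
  have aux : ∀ l x : ℝ, |l| ≤ 4 → |l * sigma t * x / Real.pi| ≤ 3 * |x| := by
    intro l x hl
    rw [abs_div, abs_mul, abs_mul, abs_of_nonneg hs0, abs_of_pos Real.pi_pos,
      div_le_iff₀ Real.pi_pos]
    -- The constant `3` comes from `4 * 2 ≤ 3 * π`.
    have h1 : |l| * sigma t ≤ 4 * 2 := mul_le_mul hl hs2 hs0 (by norm_num)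
    nlinarith [abs_nonneg x]
  have l1 : |Real.log 1.2| ≤ 4 := by
    rw [abs_of_nonneg (Real.log_nonneg (by norm_num))]
    linarith [Real.log_le_sub_one_of_pos (show (0 : ℝ) < 1.2 by norm_num)]
  have l2 : |Real.log 0.2| ≤ 4 := by
    have : (0.2 : ℝ) = 5⁻¹ := by norm_num
    rw [this, Real.log_inv, abs_neg, abs_of_nonneg (Real.log_nonneg (by norm_num))]
    linarith [Real.log_le_sub_one_of_pos (show (0 : ℝ) < 5 by norm_num)]
  refine lipschitzWith_mk (fun p q => ?_) (fun p q => ?_)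
  · have := aux _ (p.1 - q.1) l1
    have h2 := abs_fst_sub_le p q
    calc _ = |Real.log 1.2 * sigma t * (p.1 - q.1) / Real.pi| := by congr 1; ring
      _ ≤ _ := this.trans (by push_cast; linarith)
  · have := aux _ (p.2.2 - q.2.2) l2
    have h2 := abs_height_sub_le p q
    calc _ = |Real.log 0.2 * sigma t * (p.2.2 - q.2.2) / Real.pi| := by congr 1; ring
      _ ≤ _ := this.trans (by push_cast; linarith)

theorem lipschitzWith_rotate (t : ℝ) : LipschitzWith 3 fun p : ℝ × ℝ × ℝ =>
    (-(sigma t * p.2.2), (1 : ℝ), sigma t * (p.1 - 0.66)) := by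
  have hs0 := sigma_nonneg t
  have hs2 := sigma_le_two t
  have aux : ∀ x : ℝ, |sigma t * x| ≤ 3 * |x| := fun x => by
    rw [abs_mul, abs_of_nonneg hs0]; nlinarith [abs_nonneg x]
  refine lipschitzWith_mk (fun p q => ?_) (fun p q => ?_)
  · have := aux (q.2.2 - p.2.2)
    have h2 := abs_height_sub_le p q
    rw [abs_sub_comm] at h2
    calc _ = |sigma t * (q.2.2 - p.2.2)| := by congr 1; ring
      _ ≤ _ := this.trans (by push_cast; linarith)
  · have := aux (p.1 - q.1)
    have h2 := abs_fst_sub_le p q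
    calc _ = |sigma t * (p.1 - q.1)| := by congr 1; ring
      _ ≤ _ := this.trans (by push_cast; linarith)

theorem lipschitzWith_leg (t : ℝ) {z : ℝ} (hz : z ∈ Icc (-0.26 : ℝ) (-0.06)) :
    LipschitzWith 3 fun p : ℝ × ℝ × ℝ => (-(sigma t * (xi p.1 * z)), (1 : ℝ), (0 : ℝ)) := by
  have hs0 := sigma_nonneg t
  have hs2 := sigma_le_two t
  refine lipschitzWith_mk (fun p q => ?_) (fun p q => ?_)
  · have h1 := abs_xi_sub_le p.1 q.1
    have h2 := abs_fst_sub_le p q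
    have h3 : |sigma t * z| ≤ 1 := by
      rw [abs_mul, abs_of_nonneg hs0, abs_of_neg (by linarith [hz.2])]
      nlinarith [hz.1, hz.2]
    calc _ = |sigma t * z| * |xi p.1 - xi q.1| := by
          rw [← abs_neg, ← abs_mul]; congr 1; ring
      _ ≤ 1 * (3 * dist p q) := by gcongr; linarith
      _ = _ := by push_cast; ring
  · simp only [sub_self, abs_zero]
    positivity

theorem IsOrbitFrom.eventuallyEq (hδ : IsOrbitFrom q δ T) (hγ : IsOrbitFrom q γ T)
    (hT : T ≤ 2 * Real.pi) (ht : t₀ ∈ Ico 0 T) (heq : δ t₀ = γ t₀)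
    (hreg : Real.pi ≤ t₀ → IsFoldRegular (γ t₀).1 (γ t₀).2.2) :
    ∀ᶠ t in 𝓝[>] t₀, δ t = γ t := by
  rcases lt_or_ge t₀ Real.pi with h | h
  · exact eventuallyEq_of_lipschitz hδ.2 hγ.2 ht heq lipschitzWith_stretch
      (hδ.eventually_stretch ht h) (hγ.eventually_stretch ht h)
  have rot : (0.66 < (γ t₀).1 ∨ 0 < (γ t₀).2.2 ∨ (0.66 ≤ (γ t₀).1 ∧ (γ t₀).2.2 < 0)) →
      ∀ᶠ t in 𝓝[>] t₀, δ t = γ t := fun hp =>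
    eventuallyEq_of_lipschitz hδ.2 hγ.2 ht heq lipschitzWith_rotate
      (hδ.eventually_rotate hT ht h (hδ.eventually_outer hT ht h (heq ▸ hp)))
      (hγ.eventually_rotate hT ht h (hγ.eventually_outer hT ht h hp))
  rcases hreg h with hp | hp | hp | ⟨hr, hz⟩
  · exact rot (Or.inl hp)
  · exact rot (Or.inr (Or.inl hp))
  · exact rot (Or.inr (Or.inr hp))
  · refine eventuallyEq_of_lipschitz hδ.2 hγ.2 ht heq (fun t => lipschitzWith_leg t hz)
      ?_ (hγ.eventually_leg hT ht h hr hz)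
    rw [← heq] at hr hz ⊢
    exact hδ.eventually_leg hT ht h hr hz

/-- Continuous induction: the coincidence set is closed and can be extended to the right from each
regular point. Regularity is needed along one of the two orbits only. -/
theorem IsOrbitFrom.eqOn (hδ : IsOrbitFrom q δ T) (hγ : IsOrbitFrom q γ T)
    (hT : T ≤ 2 * Real.pi)
    (hreg : ∀ t ∈ Ico 0 T, Real.pi ≤ t → IsFoldRegular (γ t).1 (γ t).2.2) :
    EqOn δ γ (Icc 0 T) := by
  refine IsClosed.Icc_subset_of_forall_mem_nhdsWithin (s := {t | δ t = γ t}) ?_ ?_ ?_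
  · have := (hδ.2.continuousOn.prodMk hγ.2.continuousOn).preimage_isClosed_of_isClosed
      isClosed_Icc isClosed_diagonal
    convert this using 1
    ext t
    simp [and_comm]
  · exact hδ.1.trans hγ.1.symm
  · exact fun t ht => hδ.eventuallyEq hγ hT ht.2 ht.1 (hreg t ht.2)

end

/-! ### The explicit solution -/

theorem hasDerivAt_ite_le {E : Type*} [NormedAddCommGroup E] [NormedSpace ℝ E] {f g : ℝ → E}
    {a t : ℝ} {d : E} (hfg : f a = g a) (hf : t ≤ a → HasDerivAt f d t)
    (hg : a ≤ t → HasDerivAt g d t) :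
    HasDerivAt (fun s => if s ≤ a then f s else g s) d t := by
  rcases lt_trichotomy t a with h | h | h
  · refine (hf h.le).congr_of_eventuallyEq ?_
    filter_upwards [Iio_mem_nhds h] with s hs using if_pos (le_of_lt hs)
  · subst h
    rw [← hasDerivWithinAt_univ, ← Iic_union_Ici]
    refine HasDerivWithinAt.union ?_ ?_
    · exact (hf le_rfl).hasDerivWithinAt.congr (fun s hs => if_pos hs) (if_pos le_rfl)
    · refine (hg le_rfl).hasDerivWithinAt.congr (fun s hs => ?_) ((if_pos le_rfl).trans hfg)
      rcases (mem_Ici.1 hs).eq_or_lt with rfl | h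
      · exact (if_pos le_rfl).trans hfg
      · exact if_neg (not_le.2 h)
  · refine (hg h.le).congr_of_eventuallyEq ?_
    filter_upwards [Ioi_mem_nhds h] with s hs using if_neg (not_le.2 hs)

/-- The depth `-z(π)` below the plane `z = 0` to which the first half-turn takes height `z`. -/
noncomputable def depth (z : ℝ) : ℝ := 0.16 - z / 5

/-- The wave number of the cut-off `ξ`. -/
noncomputable def xiRate : ℝ := Real.pi / 1.2

/-- The rotation angle, times the depth, at which the point of abscissa `x` reaches `r = 0.66`;
continued linearly where `x ≥ 0.55`. -/
noncomputable def arrival (x : ℝ) : ℝ :=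
  if x ≤ 0.55 then
    Real.cos (Real.pi * (x - 0.05)) / Real.sin (Real.pi * (x - 0.05)) / xiRate
  else 1.2 * (0.55 - x)

/-- The orbit of the folding field at depth `c`, which passes `r = 0.66` for the parameter `0`. -/
noncomputable def legArch (c y : ℝ) : ℝ × ℝ :=
  if y ≤ 0 then (0.66 + Real.arctan (xiRate * c * y) / xiRate, -c)
  else (0.66 + c * Real.sin y, -(c * Real.cos y))

/-- The orbit of the folding field through `(1.2 x, -c)`, parametrized by the rotation angle. -/
noncomputable def foldCurve (x c φ : ℝ) : ℝ × ℝ :=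
  if x ≤ 0.05 then (0.06, -c)
  else if x ≤ 0.55 then legArch c (φ - arrival x / c)
  else (0.66 + 1.2 * (x - 0.55) * Real.cos φ + c * Real.sin φ,
    1.2 * (x - 0.55) * Real.sin φ - c * Real.cos φ)

/-- The solution over the first half-turn. -/
noncomputable def stretchCurve (q : ℝ × ℝ) (t : ℝ) : ℝ × ℝ × ℝ :=
  (q.1 * Real.exp (Real.log 1.2 / (2 * Real.pi) * (2 * t - Real.sin (2 * t))), t,
    -0.2 + (q.2 + 0.2) * Real.exp (Real.log 0.2 / (2 * Real.pi) * (2 * t - Real.sin (2 * t))))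

/-- The solution over a full turn. -/
noncomputable def orbit (q : ℝ × ℝ) (t : ℝ) : ℝ × ℝ × ℝ :=
  if t ≤ Real.pi then stretchCurve q t
  else ((foldCurve q.1 (depth q.2) (foldAngle t)).1, t,
    (foldCurve q.1 (depth q.2) (foldAngle t)).2)

theorem xiRate_pos : 0 < xiRate := by unfold xiRate; positivity

theorem depth_mem {z : ℝ} (hz : z ∈ Icc (-0.5 : ℝ) 0.5) : depth z ∈ Icc (0.06 : ℝ) 0.26 := by
  unfold depth; constructor <;> linarith [hz.1, hz.2]

theorem neg_depth (z : ℝ) : -depth z = -0.2 + (z + 0.2) / 5 := by unfold depth; ring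

theorem arctan_div_xiRate_mem (v : ℝ) : Real.arctan v / xiRate ∈ Ioo (-0.6 : ℝ) 0.6 := by
  have h : Real.pi / 2 = 0.6 * xiRate := by unfold xiRate; ring
  have h1 := Real.neg_pi_div_two_lt_arctan v
  have h2 := Real.arctan_lt_pi_div_two v
  rw [h] at h1 h2
  exact ⟨by rw [lt_div_iff₀ xiRate_pos]; linarith, by rw [div_lt_iff₀ xiRate_pos]; linarith⟩

/-- The shift from `0.06` to `0.66` is a quarter period, so the sine becomes a cosine of an
`arctan`. -/
theorem xi_of_leg (v : ℝ) : xi (0.66 + Real.arctan v / xiRate) = 1 / (1 + v ^ 2) := by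
  have h := (arctan_div_xiRate_mem v).1
  rw [xi, if_neg (by linarith)]
  have : Real.pi / 1.2 * (0.66 + Real.arctan v / xiRate - 0.06)
      = Real.arctan v + Real.pi / 2 := by
    have := xiRate_pos.ne'
    have e : Real.pi / 1.2 = xiRate := rfl
    have e2 : Real.pi / 2 = 0.6 * xiRate := by unfold xiRate; ring
    rw [e, e2]; field_simp; ring
  rw [this, Real.sin_add_pi_div_two, Real.cos_sq_arctan]

theorem legArch_of_nonneg {c y : ℝ} (hy : 0 ≤ y) :
    legArch c y = (0.66 + c * Real.sin y, -(c * Real.cos y)) := by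
  unfold legArch
  split_ifs with h
  · have : y = 0 := le_antisymm h hy
    subst this; simp
  · rfl

theorem legArch_of_nonpos {c y : ℝ} (hy : y ≤ 0) :
    legArch c y = (0.66 + Real.arctan (xiRate * c * y) / xiRate, -c) := if_pos hy

theorem legArch_fst_lt {c y : ℝ} (hc : 0 < c) (hy : y < 0) : (legArch c y).1 < 0.66 := by
  rw [legArch_of_nonpos hy.le]
  have h1 : xiRate * c * y < 0 := mul_neg_of_pos_of_neg (mul_pos xiRate_pos hc) hy
  have := div_neg_of_neg_of_pos (Real.arctan_lt_zero.2 h1) xiRate_pos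
  simp only
  linarith

theorem le_legArch_fst {c y : ℝ} (hc : 0 < c) (hy : y ∈ Icc 0 Real.pi) :
    0.66 ≤ (legArch c y).1 := by
  rw [legArch_of_nonneg hy.1]
  simp only
  nlinarith [Real.sin_nonneg_of_nonneg_of_le_pi hy.1 hy.2]

/-- Separating variables in `dr/dy = c ξ(r)` gives `tan (xiRate * (r - 0.66)) = xiRate * c * y`. At
the junction `y = 0` sliding and rotating have the same velocity `(c, 0)`, so the glued curve is
differentiable there although the field jumps nearby. -/
theorem hasDerivAt_legArch {c y : ℝ} (hc : c ∈ Icc (0.06 : ℝ) 0.26) (hy : y ≤ Real.pi) :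
    HasDerivAt (legArch c) (foldR (legArch c y).1 (legArch c y).2,
      foldZ (legArch c y).1 (legArch c y).2) y := by
  have hc0 : 0 < c := by linarith [hc.1]
  have hk := xiRate_pos
  refine hasDerivAt_ite_le (by simp) (fun h => ?_) (fun h => ?_)
  · have h1 : HasDerivAt (fun y => 0.66 + Real.arctan (xiRate * c * y) / xiRate)
        (c / (1 + (xiRate * c * y) ^ 2)) y := by
      have := ((((hasDerivAt_id y).const_mul (xiRate * c)).arctan).div_const xiRate).const_add
        0.66
      refine this.congr_deriv ?_
      simp only [id]
      field_simp
    have h2 : HasDerivAt (fun _ : ℝ => -c) 0 y := hasDerivAt_const _ _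
    refine (h1.prodMk h2).congr_deriv ?_
    rcases h.eq_or_lt with rfl | h
    · rw [legArch_of_nonneg le_rfl, foldR_of_mem (by left; simp), foldZ_of_mem (by left; simp)]
      simp
    · have hr := legArch_fst_lt hc0 h
      rw [legArch_of_nonpos h.le] at hr ⊢
      rw [foldR_of_leg hr ⟨by linarith [hc.2], by linarith [hc.1]⟩,
        foldZ_of_neg hr (by simpa using hc0), xi_of_leg]
      simp only [Prod.mk.injEq, and_true]
      ring
  · have h1 : HasDerivAt (fun y => 0.66 + c * Real.sin y) (c * Real.cos y) y :=
      ((Real.hasDerivAt_sin y).const_mul c).const_add 0.66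
    have h2 : HasDerivAt (fun y => -(c * Real.cos y)) (c * Real.sin y) y := by
      refine ((Real.hasDerivAt_cos y).const_mul c).neg.congr_deriv (by ring)
    refine (h1.prodMk h2).congr_deriv ?_
    have hD := le_legArch_fst hc0 ⟨h, hy⟩
    rw [foldR_of_mem (Or.inl hD), foldZ_of_mem (Or.inl hD), legArch_of_nonneg h]
    simp

section
variable {x c φ : ℝ}

theorem foldCurve_of_le (hx : x ≤ 0.05) : foldCurve x c φ = (0.06, -c) := if_pos hx

theorem foldCurve_of_mem (hx : x ∈ Ioc (0.05 : ℝ) 0.55) :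
    foldCurve x c φ = legArch c (φ - arrival x / c) := by
  rw [foldCurve, if_neg (not_le.2 hx.1), if_pos hx.2]

theorem foldCurve_of_lt (hx : 0.55 < x) :
    foldCurve x c φ = (0.66 + 1.2 * (x - 0.55) * Real.cos φ + c * Real.sin φ,
      1.2 * (x - 0.55) * Real.sin φ - c * Real.cos φ) := by
  rw [foldCurve, if_neg (by linarith), if_neg (by linarith)]

theorem arrival_of_le (hx : x ≤ 0.55) : arrival x =
    Real.cos (Real.pi * (x - 0.05)) / Real.sin (Real.pi * (x - 0.05)) / xiRate := if_pos hx

theorem sin_pos_of_mem (hx : x ∈ Ioc (0.05 : ℝ) 0.55) : 0 < Real.sin (Real.pi * (x - 0.05)) := by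
  have := Real.pi_pos
  exact Real.sin_pos_of_pos_of_lt_pi (mul_pos this (by linarith [hx.1]))
    (by nlinarith [hx.2])

theorem arrival_nonneg (hx : x ∈ Ioc (0.05 : ℝ) 0.55) : 0 ≤ arrival x := by
  have hp := Real.pi_pos
  rw [arrival_of_le hx.2]
  refine div_nonneg (div_nonneg ?_ (sin_pos_of_mem hx).le) xiRate_pos.le
  exact Real.cos_nonneg_of_mem_Icc ⟨by nlinarith [hx.1], by nlinarith [hx.2]⟩

/-- A cotangent is the tangent of the complementary angle; composed with `arctan`, the arrival
function becomes affine in `x`. Monotonicity and surjectivity of `arrival` are read off from this.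
-/
theorem arctan_arrival (hx : x ∈ Ioc (0.05 : ℝ) 0.55) :
    Real.arctan (xiRate * arrival x) = Real.pi / 2 - Real.pi * (x - 0.05) := by
  have hp := Real.pi_pos
  have hk := xiRate_pos.ne'
  have : xiRate * arrival x = Real.tan (Real.pi / 2 - Real.pi * (x - 0.05)) := by
    rw [arrival_of_le hx.2, Real.tan_pi_div_two_sub, Real.tan_eq_sin_div_cos, inv_div]
    field_simp
  rw [this, Real.arctan_tan]
  · nlinarith [hx.2]
  · nlinarith [hx.1]

theorem foldCurve_zero (hx : 0.05 ≤ x) (hc : 0 < c) : foldCurve x c 0 = (1.2 * x, -c) := by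
  rcases hx.eq_or_lt with rfl | h1
  · rw [foldCurve_of_le le_rfl]; norm_num
  rcases le_or_gt x 0.55 with h2 | h2
  · have hτ := arrival_nonneg ⟨h1, h2⟩
    rw [foldCurve_of_mem ⟨h1, h2⟩, legArch_of_nonpos (by
      rw [zero_sub]; exact neg_nonpos.2 (div_nonneg hτ hc.le))]
    have : xiRate * c * (0 - arrival x / c) = -(xiRate * arrival x) := by field_simp; ring
    rw [this, Real.arctan_neg, arctan_arrival ⟨h1, h2⟩]
    have hk := xiRate_pos.ne'
    have e : Real.pi = 1.2 * xiRate := by unfold xiRate; ring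
    rw [Prod.mk.injEq]
    refine ⟨?_, rfl⟩
    rw [e]; field_simp; ring
  · rw [foldCurve_of_lt h2]
    ext <;> simp
    ring

/-- In the first quarter-turn the point stays to the right of the axis of rotation, in the second it
is above the plane `z = 0`. -/
theorem outer_of_lt (hx : 0.55 < x) (hc : 0 < c) (hφ : φ ∈ Icc 0 Real.pi) :
    0.66 ≤ (foldCurve x c φ).1 ∨ 0 ≤ (foldCurve x c φ).2 := by
  rw [foldCurve_of_lt hx]
  have hs := Real.sin_nonneg_of_nonneg_of_le_pi hφ.1 hφ.2
  have hu : 0 < 1.2 * (x - 0.55) := by linarith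
  rcases le_total 0 (Real.cos φ) with h | h
  · left; simp only
    linarith [mul_nonneg hu.le h, mul_nonneg hc.le hs]
  · right; simp only
    linarith [mul_nonneg hu.le hs, mul_nonneg hc.le (neg_nonneg.2 h)]

theorem hasDerivAt_foldCurve (hx : 0.05 ≤ x) (hc : c ∈ Icc (0.06 : ℝ) 0.26)
    (hφ : φ ∈ Icc 0 Real.pi) :
    HasDerivAt (foldCurve x c) (foldR (foldCurve x c φ).1 (foldCurve x c φ).2,
      foldZ (foldCurve x c φ).1 (foldCurve x c φ).2) φ := by
  have hc0 : 0 < c := by linarith [hc.1]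
  rcases hx.eq_or_lt with rfl | h1
  · have e : foldCurve 0.05 c = fun _ => ((0.06 : ℝ), -c) :=
      funext fun _ => foldCurve_of_le le_rfl
    rw [e]
    simp only
    rw [foldR_of_leg (by norm_num) ⟨by linarith [hc.2], by linarith [hc.1]⟩,
      foldZ_of_neg (by norm_num) (by linarith), xi, if_pos le_rfl]
    exact (hasDerivAt_const φ ((0.06 : ℝ), -c)).congr_deriv (Prod.ext (by simp) (by simp))
  rcases le_or_gt x 0.55 with h2 | h2
  · have e : foldCurve x c = fun φ => legArch c (φ - arrival x / c) :=
      funext fun _ => foldCurve_of_mem ⟨h1, h2⟩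
    rw [e]
    exact (hasDerivAt_legArch hc (by
      linarith [hφ.2, div_nonneg (arrival_nonneg ⟨h1, h2⟩) hc0.le])).comp_sub_const φ _
  · have hD := outer_of_lt h2 hc0 hφ
    rw [foldR_of_mem hD, foldZ_of_mem hD]
    have e : foldCurve x c = _ := funext fun φ => foldCurve_of_lt (c := c) (φ := φ) h2
    rw [e]
    have a1 : HasDerivAt (fun φ => 0.66 + 1.2 * (x - 0.55) * Real.cos φ + c * Real.sin φ)
        (-(1.2 * (x - 0.55) * Real.sin φ - c * Real.cos φ)) φ :=
      ((((Real.hasDerivAt_cos φ).const_mul (1.2 * (x - 0.55))).const_add 0.66).add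
        ((Real.hasDerivAt_sin φ).const_mul c)).congr_deriv (by ring)
    have a2 : HasDerivAt (fun φ => 1.2 * (x - 0.55) * Real.sin φ - c * Real.cos φ)
        (0.66 + 1.2 * (x - 0.55) * Real.cos φ + c * Real.sin φ - 0.66) φ :=
      (((Real.hasDerivAt_sin φ).const_mul (1.2 * (x - 0.55))).sub
        ((Real.hasDerivAt_cos φ).const_mul c)).congr_deriv (by ring)
    exact a1.prodMk a2

theorem isFoldRegular_foldCurve (hx : 0.05 ≤ x) (hc : c ∈ Icc (0.06 : ℝ) 0.26)
    (hφ : φ ∈ Ico 0 Real.pi) : IsFoldRegular (foldCurve x c φ).1 (foldCurve x c φ).2 := by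
  have hc0 : 0 < c := by linarith [hc.1]
  have hz : -c ∈ Icc (-0.26 : ℝ) (-0.06) := ⟨by linarith [hc.2], by linarith [hc.1]⟩
  rcases hx.eq_or_lt with rfl | h1
  · rw [foldCurve_of_le le_rfl]
    exact Or.inr (Or.inr (Or.inr ⟨by norm_num, hz⟩))
  rcases le_or_gt x 0.55 with h2 | h2
  · rw [foldCurve_of_mem ⟨h1, h2⟩]
    have hy : φ - arrival x / c < Real.pi := by
      linarith [hφ.2, div_nonneg (arrival_nonneg ⟨h1, h2⟩) hc0.le]
    generalize φ - arrival x / c = y at hy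
    rcases lt_trichotomy y 0 with h | rfl | h
    -- This is the instant at which the leg ends at `(0.66, -c)`, the edge case in the definition of
    -- regular points.
    · refine Or.inr (Or.inr (Or.inr ⟨legArch_fst_lt hc0 h, ?_⟩))
      rwa [legArch_of_nonpos h.le]
    · refine Or.inr (Or.inr (Or.inl ?_))
      rw [legArch_of_nonneg le_rfl]
      simpa using hc0
    · left
      rw [legArch_of_nonneg h.le]
      have := mul_pos hc0 (Real.sin_pos_of_pos_of_lt_pi h hy)
      simp only
      linarith
  · rw [foldCurve_of_lt h2]
    have hu : 0 < 1.2 * (x - 0.55) := by linarith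
    rcases hφ.1.eq_or_lt with rfl | h3
    · refine Or.inr (Or.inr (Or.inl ?_))
      simp only [Real.cos_zero, Real.sin_zero]
      constructor <;> linarith
    have hs := Real.sin_pos_of_pos_of_lt_pi h3 hφ.2
    rcases le_or_gt 0 (Real.cos φ) with h | h
    · left; simp only
      linarith [mul_nonneg hu.le h, mul_pos hc0 hs]
    · right; left; simp only
      linarith [mul_pos hu hs, mul_pos hc0 (neg_pos.2 h)]

theorem foldCurve_rotate {φ₀ : ℝ} (hx : 0.05 ≤ x) (hc : 0 < c) (h₀ : φ₀ ≤ φ)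
    (hD : 0.66 ≤ (foldCurve x c φ₀).1 ∨ 0 ≤ (foldCurve x c φ₀).2) :
    (foldCurve x c φ).1 - 0.66 = ((foldCurve x c φ₀).1 - 0.66) * Real.cos (φ - φ₀)
      - (foldCurve x c φ₀).2 * Real.sin (φ - φ₀) ∧
    (foldCurve x c φ).2 = ((foldCurve x c φ₀).1 - 0.66) * Real.sin (φ - φ₀)
      + (foldCurve x c φ₀).2 * Real.cos (φ - φ₀) := by
  rcases hx.eq_or_lt with rfl | h1
  · exfalso
    rw [foldCurve_of_le le_rfl] at hD
    norm_num at hD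
    linarith
  rcases le_or_gt x 0.55 with h2 | h2
  · rw [foldCurve_of_mem ⟨h1, h2⟩] at *
    rw [foldCurve_of_mem ⟨h1, h2⟩]
    -- Before its arrival the point has `r < 0.66` and `z = -c < 0`, so an outer point lies on the
    -- circular part.
    have hy : 0 ≤ φ₀ - arrival x / c := by
      by_contra! h
      rcases hD with hD | hD
      · linarith [legArch_fst_lt hc h]
      · rw [legArch_of_nonpos h.le] at hD
        simp only at hD
        linarith
    have e : φ - φ₀ = (φ - arrival x / c) - (φ₀ - arrival x / c) := by ring
    rw [legArch_of_nonneg hy, legArch_of_nonneg (by linarith : 0 ≤ φ - arrival x / c), e,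
      Real.sin_sub (φ - arrival x / c), Real.cos_sub (φ - arrival x / c)]
    have hs := Real.sin_sq_add_cos_sq (φ₀ - arrival x / c)
    simp only
    constructor
    · linear_combination -c * Real.sin (φ - arrival x / c) * hs
    · linear_combination c * Real.cos (φ - arrival x / c) * hs
  · rw [foldCurve_of_lt h2, foldCurve_of_lt h2, Real.sin_sub, Real.cos_sub]
    have hs := Real.sin_sq_add_cos_sq φ₀
    simp only
    constructor
    · linear_combination (-(1.2 * (x - 0.55)) * Real.cos φ - c * Real.sin φ) * hs
    · linear_combination (-(1.2 * (x - 0.55)) * Real.sin φ + c * Real.cos φ) * hs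

theorem foldCurve_snd_of_inner {φ₀ : ℝ} (hx : 0.05 ≤ x) (hc : 0 < c) (hφ : φ ≤ φ₀)
    (hφ₀ : φ₀ ∈ Icc 0 Real.pi) (hr : (foldCurve x c φ₀).1 < 0.66)
    (hz : (foldCurve x c φ₀).2 < 0) : (foldCurve x c φ).2 = -c := by
  rcases hx.eq_or_lt with rfl | h1
  · rw [foldCurve_of_le le_rfl]
  rcases le_or_gt x 0.55 with h2 | h2
  · rw [foldCurve_of_mem ⟨h1, h2⟩] at *
    have hy : φ₀ - arrival x / c ≤ 0 := by
      by_contra! h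
      refine absurd hr (not_lt.2 (le_legArch_fst hc ⟨h.le, ?_⟩))
      linarith [hφ₀.2, div_nonneg (arrival_nonneg ⟨h1, h2⟩) hc.le]
    rw [legArch_of_nonpos (by linarith)]
  · rcases outer_of_lt h2 hc hφ₀ with h | h <;> linarith

theorem le_foldCurve_fst (hx : x ∈ Icc (0.05 : ℝ) 1.05) (hc : 0 < c) (hφ : φ ∈ Icc 0 Real.pi) :
    0.06 ≤ (foldCurve x c φ).1 := by
  rcases hx.1.eq_or_lt with rfl | h1
  · rw [foldCurve_of_le le_rfl]
  rcases le_or_gt x 0.55 with h2 | h2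
  · rw [foldCurve_of_mem ⟨h1, h2⟩]
    rcases le_total (φ - arrival x / c) 0 with h | h
    · rw [legArch_of_nonpos h]
      have := (arctan_div_xiRate_mem (xiRate * c * (φ - arrival x / c))).1
      simp only
      linarith
    · have := le_legArch_fst hc (y := φ - arrival x / c) ⟨h, by
        linarith [hφ.2, div_nonneg (arrival_nonneg ⟨h1, h2⟩) hc.le]⟩
      linarith
  · rw [foldCurve_of_lt h2]
    have hs := mul_nonneg hc.le (Real.sin_nonneg_of_nonneg_of_le_pi hφ.1 hφ.2)
    -- The leftmost abscissa allowed by this bound is `0.66 - 1.2 * (1.05 - 0.55) = 0.06`.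
    have : 0 ≤ 1.2 * (x - 0.55) * (1 + Real.cos φ) :=
      mul_nonneg (by linarith) (by linarith [Real.neg_one_le_cos φ])
    simp only
    linarith [hx.2]

end

/-! ### Orbits of `Q₀` over a full turn -/

/-- This is the change of time that makes the folding field autonomous. -/
theorem hasDerivAt_foldAngle (t : ℝ) : HasDerivAt foldAngle (sigma t) t := by
  refine (((hasDerivAt_id t).sub_const Real.pi).sub
    ((Real.hasDerivAt_sin t).mul (Real.hasDerivAt_cos t))).congr_deriv ?_
  unfold sigma
  linear_combination -Real.sin_sq_add_cos_sq t

theorem foldAngle_pi : foldAngle Real.pi = 0 := by simp [foldAngle]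

theorem foldAngle_two_pi : foldAngle (2 * Real.pi) = Real.pi := by
  simp [foldAngle]; ring

theorem strictMonoOn_foldAngle : StrictMonoOn foldAngle (Icc Real.pi (2 * Real.pi)) := by
  refine strictMonoOn_of_deriv_pos (convex_Icc _ _)
    (fun t _ => (hasDerivAt_foldAngle t).continuousAt.continuousWithinAt) fun t ht => ?_
  rw [interior_Icc] at ht
  rw [(hasDerivAt_foldAngle t).deriv]
  have : Real.sin t < 0 := by
    have := Real.sin_pos_of_pos_of_lt_pi (x := t - Real.pi) (by linarith [ht.1])
      (by linarith [ht.2])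
    rw [Real.sin_sub_pi] at this
    linarith
  unfold sigma
  nlinarith

theorem foldAngle_mem {t : ℝ} (ht : t ∈ Icc Real.pi (2 * Real.pi)) :
    foldAngle t ∈ Icc 0 Real.pi := by
  have hp := Real.pi_pos
  have h0 := foldAngle_pi
  have h1 := foldAngle_two_pi
  nth_rw 1 [← h0]
  nth_rw 2 [← h1]
  exact ⟨strictMonoOn_foldAngle.monotoneOn ⟨le_rfl, by linarith⟩ ht ht.1,
    strictMonoOn_foldAngle.monotoneOn ht ⟨by linarith, le_rfl⟩ ht.2⟩

theorem hasDerivAt_exp_stretch (l t : ℝ) :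
    HasDerivAt (fun t => Real.exp (l / (2 * Real.pi) * (2 * t - Real.sin (2 * t))))
      (l * sigma t * Real.exp (l / (2 * Real.pi) * (2 * t - Real.sin (2 * t))) / Real.pi) t := by
  have h2 : HasDerivAt (fun t : ℝ => 2 * t) 2 t := by
    simpa using (hasDerivAt_id t).const_mul 2
  refine (((h2.sub h2.sin).const_mul (l / (2 * Real.pi))).exp).congr_deriv ?_
  have hp := Real.pi_pos.ne'
  rw [Real.cos_two_mul, sigma, Real.sin_sq]
  simp only [Pi.sub_apply]
  field_simp
  ring

theorem hasDerivAt_stretchCurve (q : ℝ × ℝ) {t : ℝ} (ht : t ∈ Icc 0 Real.pi) :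
    HasDerivAt (stretchCurve q) (cylField (stretchCurve q t)) t := by
  unfold stretchCurve
  rw [cylField_stretch ht.1 ht.2]
  have h1 := (hasDerivAt_exp_stretch (Real.log 1.2) t).const_mul q.1
  have h2 := ((hasDerivAt_exp_stretch (Real.log 0.2) t).const_mul (q.2 + 0.2)).const_add (-0.2)
  refine (h1.prodMk ((hasDerivAt_id t).prodMk h2)).congr_deriv ?_
  ext
  · simp only; ring
  · rfl
  · simp only; ring

theorem stretchCurve_pi (q : ℝ × ℝ) :
    stretchCurve q Real.pi = (1.2 * q.1, Real.pi, -0.2 + (q.2 + 0.2) / 5) := by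
  have hp := Real.pi_pos.ne'
  have e : ∀ l : ℝ, l / (2 * Real.pi) * (2 * Real.pi - Real.sin (2 * Real.pi)) = l := fun l => by
    rw [Real.sin_two_pi]; field_simp; ring
  unfold stretchCurve
  rw [e, e, Real.exp_log (by norm_num), Real.exp_log (by norm_num)]
  ext
  · simp only; ring
  · rfl
  · simp only; ring

theorem orbit_of_le (q : ℝ × ℝ) {t : ℝ} (ht : t ≤ Real.pi) : orbit q t = stretchCurve q t :=
  if_pos ht

section
variable {q : ℝ × ℝ} {t : ℝ}

theorem foldCurve_zero_of_mem (hq : q ∈ Q0) :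
    foldCurve q.1 (depth q.2) 0 = (1.2 * q.1, -0.2 + (q.2 + 0.2) / 5) := by
  have hc := depth_mem hq.2
  rw [foldCurve_zero hq.1.1 (by linarith [hc.1]), neg_depth]

theorem orbit_of_ge (hq : q ∈ Q0) (ht : Real.pi ≤ t) :
    orbit q t = ((foldCurve q.1 (depth q.2) (foldAngle t)).1, t,
      (foldCurve q.1 (depth q.2) (foldAngle t)).2) := by
  rcases ht.eq_or_lt with rfl | h
  · rw [orbit_of_le q le_rfl, stretchCurve_pi, foldAngle_pi, foldCurve_zero_of_mem hq]
  · exact if_neg (not_le.2 h)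

theorem orbit_two_pi (hq : q ∈ Q0) :
    orbit q (2 * Real.pi) = ((foldCurve q.1 (depth q.2) Real.pi).1, 2 * Real.pi,
      (foldCurve q.1 (depth q.2) Real.pi).2) := by
  rw [orbit_of_ge hq (by linarith [Real.pi_pos]), foldAngle_two_pi]

theorem hasDerivAt_orbit (hq : q ∈ Q0) (ht : t ∈ Icc 0 (2 * Real.pi)) :
    HasDerivAt (orbit q) (cylField (orbit q t)) t := by
  refine hasDerivAt_ite_le ?_ (fun h => ?_) (fun h => ?_)
  · exact (orbit_of_le q le_rfl).symm.trans (orbit_of_ge hq le_rfl)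
  · rw [orbit_of_le q h]
    exact hasDerivAt_stretchCurve q ⟨ht.1, h⟩
  · rw [orbit_of_ge hq h, cylField_fold h ht.2]
    have h1 := HasDerivAt.scomp t (hasDerivAt_foldCurve hq.1.1 (depth_mem hq.2)
      (foldAngle_mem ⟨h, ht.2⟩)) (hasDerivAt_foldAngle t)
    have a1 : HasDerivAt (fun t => (foldCurve q.1 (depth q.2) (foldAngle t)).1) _ t := h1.fst
    have a2 : HasDerivAt (fun t => (foldCurve q.1 (depth q.2) (foldAngle t)).2) _ t := h1.snd
    exact a1.prodMk ((hasDerivAt_id t).prodMk a2)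

theorem isOrbitFrom_orbit (hq : q ∈ Q0) : IsOrbitFrom q (orbit q) (2 * Real.pi) := by
  refine ⟨?_, fun t ht => (hasDerivAt_orbit hq ht).hasDerivWithinAt⟩
  rw [orbit_of_le q Real.pi_pos.le]
  simp [stretchCurve]

theorem isFoldRegular_orbit (hq : q ∈ Q0) (ht : t < 2 * Real.pi) (ht' : Real.pi ≤ t) :
    IsFoldRegular (orbit q t).1 (orbit q t).2.2 := by
  rw [orbit_of_ge hq ht']
  refine isFoldRegular_foldCurve hq.1.1 (depth_mem hq.2)
    ⟨(foldAngle_mem ⟨ht', ht.le⟩).1, ?_⟩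
  rw [← foldAngle_two_pi]
  exact strictMonoOn_foldAngle ⟨ht', ht.le⟩ ⟨by linarith, le_rfl⟩ ht

theorem IsOrbitFrom.eqOn_orbit {δ : ℝ → ℝ × ℝ × ℝ} {T : ℝ} (hq : q ∈ Q0)
    (hδ : IsOrbitFrom q δ T) (hT : T ≤ 2 * Real.pi) : EqOn δ (orbit q) (Icc 0 T) :=
  hδ.eqOn ((isOrbitFrom_orbit hq).mono hT) hT
    fun _ ht ht' => isFoldRegular_orbit hq (ht.2.trans_le hT) ht'

/-! ### First return to the square -/

theorem orbit_fst_pos (hq : q ∈ Q0) (ht : t ∈ Icc 0 (2 * Real.pi)) : 0 < (orbit q t).1 := by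
  rcases le_total t Real.pi with h | h
  · rw [orbit_of_le q h]
    exact mul_pos (by linarith [hq.1.1]) (Real.exp_pos _)
  · rw [orbit_of_ge hq h]
    have hc := depth_mem hq.2
    have := le_foldCurve_fst hq.1 (c := depth q.2) (by linarith [hc.1])
      (foldAngle_mem ⟨h, ht.2⟩)
    simp only
    linarith

theorem orbit_snd (hq : q ∈ Q0) (ht : t ∈ Icc 0 (2 * Real.pi)) : (orbit q t).2.1 = t :=
  (isOrbitFrom_orbit hq).angle_eq ht

/-- As `r > 0`, the plane `y = 0` is met inside the open turn only at the angle `π`, and there the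
abscissa is negative. -/
theorem toCart_orbit_notMem (hq : q ∈ Q0) (ht : t ∈ Ioo 0 (2 * Real.pi)) :
    toCart (orbit q t) ∉ toSpace '' Q0 := by
  rintro ⟨p, hp, h⟩
  have ht' := Ioo_subset_Icc_self ht
  have hr := orbit_fst_pos hq ht'
  simp only [toCart, toSpace, orbit_snd hq ht', Prod.mk.injEq] at h
  have hs : Real.sin t = 0 := by
    rcases mul_eq_zero.1 h.2.1.symm with h0 | h0
    · exact absurd h0 hr.ne'
    · exact h0
  have hc : 0 < Real.cos t := by
    have : 0 < (orbit q t).1 * Real.cos t := by rw [← h.1]; linarith [hp.1.1]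
    exact pos_of_mul_pos_right this hr.le
  have h1 : t = Real.pi := by
    rcases lt_trichotomy t Real.pi with h2 | h2 | h2
    · exact absurd hs (Real.sin_pos_of_pos_of_lt_pi ht.1 h2).ne'
    · exact h2
    · have := Real.sin_pos_of_pos_of_lt_pi (x := t - Real.pi) (by linarith) (by linarith [ht.2])
      rw [Real.sin_sub_pi] at this
      linarith
  rw [h1, Real.cos_pi] at hc
  linarith

theorem toCart_orbit_two_pi (hq : q ∈ Q0) :
    toCart (orbit q (2 * Real.pi)) = toSpace (foldCurve q.1 (depth q.2) Real.pi) := by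
  rw [orbit_two_pi hq]
  simp [toCart, toSpace]

theorem toSpace_injective : Function.Injective toSpace := fun a b h => by
  simp only [toSpace, Prod.mk.injEq] at h
  exact Prod.ext h.1 h.2.2

theorem isFirstReturn_iff (hq : q ∈ Q0)
    (hP : foldCurve q.1 (depth q.2) Real.pi ∈ Q0) (q' : ℝ × ℝ) :
    IsFirstReturn q q' ↔ q' = foldCurve q.1 (depth q.2) Real.pi := by
  have hp := Real.two_pi_pos
  constructor
  · rintro ⟨γ, T, hT, hγ, hq', hγT, hno⟩
    -- A later return is impossible, since the orbit already meets the square at `2π`.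
    have hle : T ≤ 2 * Real.pi := by
      by_contra! h
      have h1 := (hγ.mono h.le).eqOn_orbit hq le_rfl ⟨hp.le, le_rfl⟩
      apply hno _ ⟨hp, h⟩
      rw [h1, toCart_orbit_two_pi hq]
      exact mem_image_of_mem _ hP
    have h1 := hγ.eqOn_orbit hq hle ⟨hT.le, le_rfl⟩
    rw [h1] at hγT
    rcases hle.eq_or_lt with rfl | hlt
    · rw [toCart_orbit_two_pi hq] at hγT
      exact (toSpace_injective hγT).symm
    · exact absurd (hγT ▸ mem_image_of_mem _ hq') (toCart_orbit_notMem hq ⟨hT, hlt⟩)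
  · rintro rfl
    exact ⟨orbit q, 2 * Real.pi, hp, isOrbitFrom_orbit hq, hP, toCart_orbit_two_pi hq,
      fun t ht => toCart_orbit_notMem hq ht⟩

end

/-! ### A global formula for the return map -/

/-- `cos` on `[0, π]`, continued by constants. -/
noncomputable def bendCos (ψ : ℝ) : ℝ := Real.cos (max 0 (min ψ Real.pi))

/-- `sin` on `[0, π]`, continued linearly. -/
noncomputable def bendSin (ψ : ℝ) : ℝ :=
  if ψ ≤ 0 then ψ else if ψ ≤ Real.pi then Real.sin ψ else Real.pi - ψ

/-- The deviation of the motion along the lower leg from uniform motion. -/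
noncomputable def legLag (v : ℝ) : ℝ :=
  if v ≤ 0 then 0 else v - Real.arctan (xiRate * v) / xiRate

/-- The derivative of `legLag`. -/
noncomputable def legLagDeriv (v : ℝ) : ℝ := 1 - 1 / (1 + (xiRate * max v 0) ^ 2)

/-- The derivative of `arrival`. -/
noncomputable def arrivalDeriv (x : ℝ) : ℝ :=
  -1.2 / Real.sin (Real.pi * (min x 0.55 - 0.05)) ^ 2

/-- The image of `(x, z)` on the lower leg, in a form that makes sense at `x = 0.05`. -/
noncomputable def lowerLeg (q : ℝ × ℝ) : ℝ × ℝ :=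
  (0.06 + Real.arctan (Real.sin (Real.pi * (q.1 - 0.05)) /
    (Real.cos (Real.pi * (q.1 - 0.05)) -
      xiRate * Real.pi * depth q.2 * Real.sin (Real.pi * (q.1 - 0.05)))) / xiRate, -depth q.2)

/-- The return map for `x > 0.05`. -/
noncomputable def bendMap (q : ℝ × ℝ) : ℝ × ℝ :=
  (0.66 + depth q.2 * bendSin (arrival q.1 / depth q.2) +
      legLag (arrival q.1 - Real.pi * depth q.2),
    depth q.2 * bendCos (arrival q.1 / depth q.2))

/-- The return map of `Q₀`, extended to a neighbourhood of `Q₀`. -/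
noncomputable def returnMap (q : ℝ × ℝ) : ℝ × ℝ := if q.1 ≤ 0.05 then lowerLeg q else bendMap q

theorem bendCos_of_nonpos {ψ : ℝ} (h : ψ ≤ 0) : bendCos ψ = 1 := by
  rw [bendCos, max_eq_left ((min_le_left _ _).trans h), Real.cos_zero]

theorem bendCos_of_mem {ψ : ℝ} (h : ψ ∈ Icc 0 Real.pi) : bendCos ψ = Real.cos ψ := by
  rw [bendCos, min_eq_left h.2, max_eq_right h.1]

theorem bendCos_of_ge {ψ : ℝ} (h : Real.pi ≤ ψ) : bendCos ψ = -1 := by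
  rw [bendCos, min_eq_right h, max_eq_right Real.pi_pos.le, Real.cos_pi]

theorem bendSin_of_nonpos {ψ : ℝ} (h : ψ ≤ 0) : bendSin ψ = ψ := if_pos h

theorem bendSin_of_mem {ψ : ℝ} (h : ψ ∈ Icc 0 Real.pi) : bendSin ψ = Real.sin ψ := by
  rcases h.1.eq_or_lt with rfl | h0
  · simp [bendSin]
  · rw [bendSin, if_neg (not_le.2 h0), if_pos h.2]

theorem bendSin_of_ge {ψ : ℝ} (h : Real.pi ≤ ψ) : bendSin ψ = Real.pi - ψ := by
  have hp := Real.pi_pos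
  rcases h.eq_or_lt with rfl | h0
  · rw [bendSin_of_mem ⟨hp.le, le_rfl⟩]; simp
  · rw [bendSin, if_neg (by linarith), if_neg (not_le.2 h0)]

theorem legLag_of_nonpos {v : ℝ} (h : v ≤ 0) : legLag v = 0 := if_pos h

theorem legLag_of_nonneg {v : ℝ} (h : 0 ≤ v) :
    legLag v = v - Real.arctan (xiRate * v) / xiRate := by
  rcases h.eq_or_lt with rfl | h0
  · simp [legLag]
  · exact if_neg (not_le.2 h0)

theorem legLagDeriv_of_nonpos {v : ℝ} (h : v ≤ 0) : legLagDeriv v = 0 := by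
  rw [legLagDeriv, max_eq_right h]; simp

theorem hasDerivAt_bendSin (ψ : ℝ) : HasDerivAt bendSin (bendCos ψ) ψ := by
  have hp := Real.pi_pos
  have h : bendSin = fun s => if s ≤ 0 then s else if s ≤ Real.pi then Real.sin s else
    Real.pi - s := rfl
  rw [h]
  refine hasDerivAt_ite_le (g := fun s => if s ≤ Real.pi then Real.sin s else Real.pi - s)
    (by simp [hp.le]) (fun h => ?_) (fun h => ?_)
  · rw [bendCos_of_nonpos h]; exact hasDerivAt_id ψ
  · refine hasDerivAt_ite_le (by simp) (fun h' => ?_) (fun h' => ?_)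
    · rw [bendCos_of_mem ⟨h, h'⟩]; exact Real.hasDerivAt_sin ψ
    · rw [bendCos_of_ge h']; exact (hasDerivAt_id ψ).const_sub Real.pi

theorem hasDerivAt_bendCos (ψ : ℝ) :
    HasDerivAt bendCos (-Real.sin (max 0 (min ψ Real.pi))) ψ := by
  have hp := Real.pi_pos
  have h : bendCos = fun s => if s ≤ 0 then 1 else if s ≤ Real.pi then Real.cos s else -1 := by
    funext s
    split_ifs with h1 h2
    · exact bendCos_of_nonpos h1
    · exact bendCos_of_mem ⟨(not_le.1 h1).le, h2⟩
    · exact bendCos_of_ge (not_le.1 h2).le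
  rw [h]
  refine hasDerivAt_ite_le (g := fun s => if s ≤ Real.pi then Real.cos s else -1)
    (by simp [hp.le]) (fun h => ?_) (fun h => ?_)
  · rw [max_eq_left ((min_le_left _ _).trans h), Real.sin_zero, neg_zero]
    exact hasDerivAt_const _ _
  · refine hasDerivAt_ite_le (by simp) (fun h' => ?_) (fun h' => ?_)
    · rw [min_eq_left h', max_eq_right h]; exact Real.hasDerivAt_cos ψ
    · rw [min_eq_right h', max_eq_right hp.le, Real.sin_pi, neg_zero]
      exact hasDerivAt_const _ _

theorem hasDerivAt_legLag (v : ℝ) : HasDerivAt legLag (legLagDeriv v) v := by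
  have hk := xiRate_pos.ne'
  refine hasDerivAt_ite_le (by simp) (fun h => ?_) (fun h => ?_)
  · rw [legLagDeriv_of_nonpos h]; exact hasDerivAt_const _ _
  · rw [legLagDeriv, max_eq_left h]
    refine ((hasDerivAt_id v).sub
      ((((hasDerivAt_id v).const_mul xiRate).arctan).div_const xiRate)).congr_deriv ?_
    simp only [id]
    field_simp

/-- The linear continuation has slope `-1.2` because the cotangent has derivative `-1` at `π / 2`
and `π / xiRate = 1.2`. -/
theorem hasDerivAt_arrival {x : ℝ} (hx : 0.05 < x) :
    HasDerivAt arrival (arrivalDeriv x) x := by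
  have hp := Real.pi_pos
  have hk := xiRate_pos.ne'
  have h55 : Real.pi * (0.55 - 0.05) = Real.pi / 2 := by ring
  refine hasDerivAt_ite_le ?_ (fun h => ?_) (fun h => ?_)
  · rw [h55]; simp
  · rw [arrivalDeriv, min_eq_left h]
    have hs := (sin_pos_of_mem ⟨hx, h⟩).ne'
    have hw : HasDerivAt (fun x => Real.pi * (x - 0.05)) Real.pi x := by
      simpa using ((hasDerivAt_id x).sub_const 0.05).const_mul Real.pi
    refine ((hw.cos.div hw.sin hs).div_const xiRate).congr_deriv ?_
    have e : Real.pi = 1.2 * xiRate := by unfold xiRate; ring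
    have h1 := Real.sin_sq_add_cos_sq (Real.pi * (x - 0.05))
    have h2 : -Real.sin (Real.pi * (x - 0.05)) * Real.pi * Real.sin (Real.pi * (x - 0.05)) -
      Real.cos (Real.pi * (x - 0.05)) * (Real.cos (Real.pi * (x - 0.05)) * Real.pi)
      = -(1.2 * xiRate) := by
      rw [← e]; linear_combination -Real.pi * h1
    rw [h2]
    field_simp
  · rw [arrivalDeriv, min_eq_right h, h55, Real.sin_pi_div_two]
    have := ((hasDerivAt_id x).const_sub 0.55).const_mul 1.2
    exact this.congr_deriv (by norm_num)

/-! ### Smoothness of the return map -/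

theorem contDiff_one_of_hasDerivAt {f f' : ℝ → ℝ} (h : ∀ x, HasDerivAt f (f' x) x)
    (hc : Continuous f') : ContDiff ℝ 1 f := by
  rw [contDiff_one_iff_deriv]
  exact ⟨fun x => (h x).differentiableAt, by rwa [show deriv f = f' from funext fun x => (h x).deriv]⟩

theorem contDiff_bendCos : ContDiff ℝ 1 bendCos :=
  contDiff_one_of_hasDerivAt hasDerivAt_bendCos (by fun_prop)

theorem contDiff_bendSin : ContDiff ℝ 1 bendSin :=
  contDiff_one_of_hasDerivAt hasDerivAt_bendSin contDiff_bendCos.continuous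

theorem contDiff_legLag : ContDiff ℝ 1 legLag := by
  refine contDiff_one_of_hasDerivAt hasDerivAt_legLag ?_
  unfold legLagDeriv
  have : ∀ v : ℝ, 1 + (xiRate * max v 0) ^ 2 ≠ 0 := fun v => by positivity
  fun_prop (disch := assumption)

theorem sin_min_pos {x : ℝ} (hx : 0.05 < x) :
    0 < Real.sin (Real.pi * (min x 0.55 - 0.05)) :=
  sin_pos_of_mem ⟨lt_min hx (by norm_num), min_le_right _ _⟩

theorem contDiffAt_arrival {x : ℝ} (hx : 0.05 < x) : ContDiffAt ℝ 1 arrival x := by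
  have : ContDiffOn ℝ 1 arrival (Ioi 0.05) := by
    rw [show (1 : WithTop ℕ∞) = 0 + 1 from (zero_add 1).symm,
      contDiffOn_succ_iff_deriv_of_isOpen isOpen_Ioi]
    refine ⟨fun y hy => (hasDerivAt_arrival hy).differentiableAt.differentiableWithinAt,
      by simp, ?_⟩
    rw [contDiffOn_zero]
    refine ContinuousOn.congr (f := arrivalDeriv) ?_ fun y hy => (hasDerivAt_arrival hy).deriv
    unfold arrivalDeriv
    refine ContinuousOn.div continuousOn_const (by fun_prop) fun y hy => ?_
    exact (pow_pos (sin_min_pos hy) 2).ne'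
  exact this.contDiffAt (Ioi_mem_nhds hx)

theorem depth_pos {z : ℝ} (hz : z < 0.8) : 0 < depth z := by unfold depth; linarith

theorem hasDerivAt_depth (z : ℝ) : HasDerivAt depth (-1 / 5) z :=
  (((hasDerivAt_id z).div_const 5).const_sub 0.16).congr_deriv (by ring)

theorem contDiff_depth : ContDiff ℝ 1 depth :=
  contDiff_one_of_hasDerivAt hasDerivAt_depth continuous_const

theorem contDiffAt_bendMap {q : ℝ × ℝ} (hx : 0.05 < q.1) (hz : q.2 < 0.8) :
    ContDiffAt ℝ 1 bendMap q := by
  have hd : ContDiffAt ℝ 1 (fun q : ℝ × ℝ => depth q.2) q :=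
    (contDiff_depth.comp contDiff_snd).contDiffAt
  have ha : ContDiffAt ℝ 1 (fun q : ℝ × ℝ => arrival q.1) q :=
    ContDiffAt.comp q (contDiffAt_arrival hx) contDiffAt_fst
  have hψ := ha.div hd (depth_pos hz).ne'
  have h1 : ContDiffAt ℝ 1 (fun q : ℝ × ℝ => bendSin (arrival q.1 / depth q.2)) q :=
    ContDiffAt.comp (g := bendSin) q contDiff_bendSin.contDiffAt hψ
  have h2 : ContDiffAt ℝ 1 (fun q : ℝ × ℝ => bendCos (arrival q.1 / depth q.2)) q :=
    ContDiffAt.comp (g := bendCos) q contDiff_bendCos.contDiffAt hψ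
  have h3 : ContDiffAt ℝ 1 (fun q : ℝ × ℝ => legLag (arrival q.1 - Real.pi * depth q.2)) q :=
    ContDiffAt.comp q contDiff_legLag.contDiffAt (ha.sub (contDiffAt_const.mul hd))
  exact ((contDiffAt_const.add (hd.mul h1)).add h3).prodMk (hd.mul h2)

theorem contDiffAt_lowerLeg {q : ℝ × ℝ} (hq : Real.cos (Real.pi * (q.1 - 0.05)) -
      xiRate * Real.pi * depth q.2 * Real.sin (Real.pi * (q.1 - 0.05)) ≠ 0) :
    ContDiffAt ℝ 1 lowerLeg q := by
  have hd : ContDiffAt ℝ 1 (fun q : ℝ × ℝ => depth q.2) q :=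
    (contDiff_depth.comp contDiff_snd).contDiffAt
  have hw : ContDiffAt ℝ 1 (fun q : ℝ × ℝ => Real.pi * (q.1 - 0.05)) q := by fun_prop
  have h1 := (hw.sin.div (hw.cos.sub ((contDiffAt_const (c := xiRate * Real.pi)).mul hd
    |>.mul hw.sin)) hq).arctan
  exact (contDiffAt_const.add (h1.div_const xiRate)).prodMk hd.neg

section
variable {q : ℝ × ℝ}

theorem returnMap_of_le (hx : q.1 ≤ 0.05) : returnMap q = lowerLeg q := if_pos hx

theorem returnMap_of_gt (hx : 0.05 < q.1) : returnMap q = bendMap q := if_neg (not_le.2 hx)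

theorem returnMap_upper (hx : 0.05 < q.1) (hz : q.2 < 0.8) (hT : arrival q.1 ≤ 0) :
    returnMap q = (0.66 + arrival q.1, depth q.2) := by
  have hc := depth_pos hz
  have hψ : arrival q.1 / depth q.2 ≤ 0 := div_nonpos_of_nonpos_of_nonneg hT hc.le
  rw [returnMap_of_gt hx, bendMap, bendSin_of_nonpos hψ, bendCos_of_nonpos hψ,
    legLag_of_nonpos (by nlinarith [Real.pi_pos])]
  ext
  · simp only; field_simp; ring
  · simp

theorem returnMap_arch (hx : 0.05 < q.1) (hz : q.2 < 0.8)
    (hT : arrival q.1 ∈ Icc 0 (Real.pi * depth q.2)) :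
    returnMap q = (0.66 + depth q.2 * Real.sin (arrival q.1 / depth q.2),
      depth q.2 * Real.cos (arrival q.1 / depth q.2)) := by
  have hc := depth_pos hz
  have hψ : arrival q.1 / depth q.2 ∈ Icc 0 Real.pi :=
    ⟨div_nonneg hT.1 hc.le, by rw [div_le_iff₀ hc]; exact hT.2⟩
  rw [returnMap_of_gt hx, bendMap, bendSin_of_mem hψ, bendCos_of_mem hψ,
    legLag_of_nonpos (by linarith [hT.2]), add_zero]

theorem returnMap_leg (hx : 0.05 < q.1) (hz : q.2 < 0.8)
    (hT : Real.pi * depth q.2 ≤ arrival q.1) :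
    returnMap q = (0.66 - Real.arctan (xiRate * (arrival q.1 - Real.pi * depth q.2)) / xiRate,
      -depth q.2) := by
  have hc := depth_pos hz
  have hψ : Real.pi ≤ arrival q.1 / depth q.2 := by rwa [le_div_iff₀ hc]
  rw [returnMap_of_gt hx, bendMap, bendSin_of_ge hψ, bendCos_of_ge hψ,
    legLag_of_nonneg (by linarith)]
  ext
  · simp only; field_simp; ring
  · simp

/-- The identity `arctan (1 / u) = π / 2 - arctan u` for `u > 0` replaces a quantity that blows up
at `x = 0.05` by one that tends to `0`. -/
theorem returnMap_eq_lowerLeg (hx : q.1 < 0.55) (hz : q.2 < 0.8)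
    (hq : 0 < Real.cos (Real.pi * (q.1 - 0.05)) -
      xiRate * Real.pi * depth q.2 * Real.sin (Real.pi * (q.1 - 0.05))) :
    returnMap q = lowerLeg q := by
  rcases le_or_gt q.1 0.05 with h | h
  · exact returnMap_of_le h
  have hk := xiRate_pos
  have hs := sin_pos_of_mem ⟨h, hx.le⟩
  have e1 : xiRate * (arrival q.1 - Real.pi * depth q.2) =
      (Real.sin (Real.pi * (q.1 - 0.05)) / (Real.cos (Real.pi * (q.1 - 0.05)) -
      xiRate * Real.pi * depth q.2 * Real.sin (Real.pi * (q.1 - 0.05))))⁻¹ := by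
    rw [arrival_of_le hx.le, inv_div]
    field_simp
  have e2 := div_pos hs hq
  rw [returnMap_leg h hz, lowerLeg, e1, Real.arctan_inv_of_pos e2]
  · have e : Real.pi / 2 = 0.6 * xiRate := by unfold xiRate; ring
    rw [e, Prod.mk.injEq]
    refine ⟨?_, rfl⟩
    field_simp
    ring
  · have := inv_pos.2 e2
    rw [← e1] at this
    linarith [pos_of_mul_pos_right this hk.le]

end

/-- The neighbourhood of `Q₀` on which the return map is continued. -/
def returnDomain : Set (ℝ × ℝ) := {q | -0.45 < q.1 ∧ q.2 < 0.8}

theorem isOpen_returnDomain : IsOpen returnDomain :=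
  (isOpen_lt continuous_const continuous_fst).inter (isOpen_lt continuous_snd continuous_const)

theorem Q0_subset_returnDomain : Q0 ⊆ returnDomain := fun q hq => by
  refine ⟨?_, ?_⟩ <;> linarith [hq.1.1, hq.2.2]

/-- The bound `-0.45` keeps the angle above `-π / 2`, where the cosine is positive; the sine is
nonpositive, so the subtracted term only helps. -/
theorem lowerLeg_denom_pos {q : ℝ × ℝ} (hq : q ∈ returnDomain) (hx : q.1 ≤ 0.05) :
    0 < Real.cos (Real.pi * (q.1 - 0.05)) -
      xiRate * Real.pi * depth q.2 * Real.sin (Real.pi * (q.1 - 0.05)) := by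
  have hp := Real.pi_pos
  have h1 : 0 < Real.cos (Real.pi * (q.1 - 0.05)) :=
    Real.cos_pos_of_mem_Ioo ⟨by nlinarith [hq.1], by nlinarith⟩
  have h2 : Real.sin (Real.pi * (q.1 - 0.05)) ≤ 0 :=
    Real.sin_nonpos_of_nonpos_of_neg_pi_le (by nlinarith) (by nlinarith [hq.1])
  have h3 : 0 < xiRate * Real.pi * depth q.2 :=
    mul_pos (mul_pos xiRate_pos hp) (depth_pos hq.2)
  nlinarith

theorem returnMap_eventuallyEq {q : ℝ × ℝ} (hq : q ∈ returnDomain) (hx : q.1 ≤ 0.05) :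
    returnMap =ᶠ[𝓝 q] lowerLeg := by
  have h1 : ∀ᶠ p : ℝ × ℝ in 𝓝 q, p.1 < 0.55 :=
    continuous_fst.continuousAt.eventually_lt_const (by linarith)
  have h2 : ∀ᶠ p : ℝ × ℝ in 𝓝 q, 0 < Real.cos (Real.pi * (p.1 - 0.05)) -
      xiRate * Real.pi * depth p.2 * Real.sin (Real.pi * (p.1 - 0.05)) := by
    have hc : ContinuousAt (fun p : ℝ × ℝ => Real.cos (Real.pi * (p.1 - 0.05)) -
        xiRate * Real.pi * depth p.2 * Real.sin (Real.pi * (p.1 - 0.05))) q := by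
      unfold depth
      fun_prop
    exact hc.eventually_const_lt (lowerLeg_denom_pos hq hx)
  filter_upwards [h1, h2, isOpen_returnDomain.mem_nhds hq] with p h1 h2 h3
  exact returnMap_eq_lowerLeg h1 h3.2 h2

theorem contDiffAt_returnMap {q : ℝ × ℝ} (hq : q ∈ returnDomain) :
    ContDiffAt ℝ 1 returnMap q := by
  rcases le_or_gt q.1 0.05 with h | h
  · exact (contDiffAt_lowerLeg (lowerLeg_denom_pos hq h).ne').congr_of_eventuallyEq
      (returnMap_eventuallyEq hq h)
  · refine (contDiffAt_bendMap h hq.2).congr_of_eventuallyEq ?_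
    filter_upwards [continuous_fst.continuousAt.eventually_const_lt h] with p hp
    exact returnMap_of_gt hp

/-! ### The derivative of the return map -/

theorem fderiv_apply_fst {F : ℝ × ℝ → ℝ × ℝ} {q d : ℝ × ℝ} (hF : DifferentiableAt ℝ F q)
    (h : HasDerivAt (fun x => F (x, q.2)) d q.1) : fderiv ℝ F q (1, 0) = d := by
  have h1 : HasDerivAt (fun x => (x, q.2)) ((1 : ℝ), (0 : ℝ)) q.1 :=
    (hasDerivAt_id _).prodMk (hasDerivAt_const _ _)
  have h2 : HasDerivAt (fun x => F (x, q.2)) (fderiv ℝ F q (1, 0)) q.1 :=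
    HasFDerivAt.comp_hasDerivAt (l := F) q.1 hF.hasFDerivAt h1
  exact h2.unique h

theorem fderiv_apply_snd {F : ℝ × ℝ → ℝ × ℝ} {q d : ℝ × ℝ} (hF : DifferentiableAt ℝ F q)
    (h : HasDerivAt (fun z => F (q.1, z)) d q.2) : fderiv ℝ F q (0, 1) = d := by
  have h1 : HasDerivAt (fun z => (q.1, z)) ((0 : ℝ), (1 : ℝ)) q.2 :=
    (hasDerivAt_const _ _).prodMk (hasDerivAt_id _)
  have h2 : HasDerivAt (fun z => F (q.1, z)) (fderiv ℝ F q (0, 1)) q.2 :=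
    HasFDerivAt.comp_hasDerivAt (l := F) q.2 hF.hasFDerivAt h1
  exact h2.unique h

theorem differentiableAt_returnMap {q : ℝ × ℝ} (hq : q ∈ returnDomain) :
    DifferentiableAt ℝ returnMap q :=
  (contDiffAt_returnMap hq).differentiableAt one_ne_zero

section
variable {q : ℝ × ℝ}

theorem fderiv_returnMap_of_gt (hx : 0.05 < q.1) :
    fderiv ℝ returnMap q = fderiv ℝ bendMap q := by
  refine Filter.EventuallyEq.fderiv_eq ?_
  filter_upwards [continuous_fst.continuousAt.eventually_const_lt hx] with p hp
  exact returnMap_of_gt hp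

theorem fderiv_returnMap_fst (hx : 0.05 < q.1) (hz : q.2 < 0.8) :
    fderiv ℝ returnMap q (1, 0) =
      (arrivalDeriv q.1 * (bendCos (arrival q.1 / depth q.2) +
          legLagDeriv (arrival q.1 - Real.pi * depth q.2)),
        -(arrivalDeriv q.1 *
          Real.sin (max 0 (min (arrival q.1 / depth q.2) Real.pi)))) := by
  have hc := (depth_pos hz).ne'
  rw [fderiv_returnMap_of_gt hx]
  refine fderiv_apply_fst ((contDiffAt_bendMap hx hz).differentiableAt one_ne_zero) ?_
  have ha := hasDerivAt_arrival hx
  have h1 := ((hasDerivAt_bendSin (arrival q.1 / depth q.2)).comp q.1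
    (ha.div_const (depth q.2))).const_mul (depth q.2)
  have h2 := ((hasDerivAt_bendCos (arrival q.1 / depth q.2)).comp q.1
    (ha.div_const (depth q.2))).const_mul (depth q.2)
  have h3 := (hasDerivAt_legLag (arrival q.1 - Real.pi * depth q.2)).comp q.1
    (ha.sub_const (Real.pi * depth q.2))
  refine (((h1.const_add 0.66).add h3).prodMk h2).congr_deriv ?_
  ext
  · simp only; field_simp
  · simp only; field_simp

theorem fderiv_returnMap_snd (hx : 0.05 < q.1) (hz : q.2 < 0.8) :
    fderiv ℝ returnMap q (0, 1) =
      (-1 / 5 * (bendSin (arrival q.1 / depth q.2) -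
          bendCos (arrival q.1 / depth q.2) * (arrival q.1 / depth q.2) -
          Real.pi * legLagDeriv (arrival q.1 - Real.pi * depth q.2)),
        -1 / 5 * (bendCos (arrival q.1 / depth q.2) +
          Real.sin (max 0 (min (arrival q.1 / depth q.2) Real.pi)) *
            (arrival q.1 / depth q.2))) := by
  have hc := (depth_pos hz).ne'
  rw [fderiv_returnMap_of_gt hx]
  refine fderiv_apply_snd ((contDiffAt_bendMap hx hz).differentiableAt one_ne_zero) ?_
  have hd := hasDerivAt_depth q.2
  have hψ := (hasDerivAt_const q.2 (arrival q.1)).div hd hc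
  have h1 := hd.mul ((hasDerivAt_bendSin (arrival q.1 / depth q.2)).comp q.2 hψ)
  have h2 := hd.mul ((hasDerivAt_bendCos (arrival q.1 / depth q.2)).comp q.2 hψ)
  have h3 := (hasDerivAt_legLag (arrival q.1 - Real.pi * depth q.2)).comp q.2
    ((hd.const_mul Real.pi).const_sub (arrival q.1))
  refine (((h1.const_add 0.66).add h3).prodMk h2).congr_deriv ?_
  ext
  · simp only [Function.comp, Pi.div_apply]; field_simp; ring
  · simp only [Function.comp, Pi.div_apply]; field_simp; ring

theorem fderiv_returnMap_fst_of_le (hq : q ∈ returnDomain) (hx : q.1 ≤ 0.05) :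
    fderiv ℝ returnMap q (1, 0) = (1.2 / ((Real.cos (Real.pi * (q.1 - 0.05)) -
      xiRate * Real.pi * depth q.2 * Real.sin (Real.pi * (q.1 - 0.05))) ^ 2 +
        Real.sin (Real.pi * (q.1 - 0.05)) ^ 2), 0) := by
  have hden := lowerLeg_denom_pos hq hx
  rw [(returnMap_eventuallyEq hq hx).fderiv_eq]
  refine fderiv_apply_fst ((contDiffAt_lowerLeg hden.ne').differentiableAt one_ne_zero) ?_
  have hw : HasDerivAt (fun x => Real.pi * (x - 0.05)) Real.pi q.1 := by
    simpa using ((hasDerivAt_id q.1).sub_const 0.05).const_mul Real.pi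
  have h1 := ((((hw.sin.div (hw.cos.sub (hw.sin.const_mul
    (xiRate * Real.pi * depth q.2))) hden.ne').arctan).div_const xiRate).const_add 0.06)
  refine (h1.prodMk (hasDerivAt_const q.1 (-depth q.2))).congr_deriv ?_
  have hs := Real.sin_sq_add_cos_sq (Real.pi * (q.1 - 0.05))
  have hk := xiRate_pos.ne'
  have e : Real.pi = 1.2 * xiRate := by unfold xiRate; ring
  rw [Prod.mk.injEq]
  refine ⟨?_, rfl⟩
  simp only [Pi.div_apply, Pi.sub_apply]
  generalize xiRate * Real.pi * depth q.2 = a at *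
  generalize Real.sin (Real.pi * (q.1 - 0.05)) = s at *
  generalize Real.cos (Real.pi * (q.1 - 0.05)) = c at *
  have h0 : c - a * s ≠ 0 := hden.ne'
  have h2 : (c - a * s) ^ 2 + s ^ 2 ≠ 0 := by positivity
  have h3 : c * Real.pi * (c - a * s) - s * (-s * Real.pi - a * (c * Real.pi)) = Real.pi := by
    linear_combination Real.pi * hs
  have h4 : 1 + (s / (c - a * s)) ^ 2 = ((c - a * s) ^ 2 + s ^ 2) / (c - a * s) ^ 2 := by
    rw [div_pow, add_div, div_self (pow_ne_zero 2 h0)]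
  rw [h3, h4, e]
  generalize c - a * s = d at *
  field_simp

/-- Here `DF(1,0)` is horizontal, so this component alone determines the determinant. -/
theorem fderiv_returnMap_snd_snd_of_le (hq : q ∈ returnDomain) (hx : q.1 ≤ 0.05) :
    (fderiv ℝ returnMap q (0, 1)).2 = 1 / 5 := by
  have hF := differentiableAt_returnMap hq
  have h1 : HasDerivAt (fun z => (q.1, z)) ((0 : ℝ), (1 : ℝ)) q.2 :=
    (hasDerivAt_const _ _).prodMk (hasDerivAt_id _)
  have h2 : HasDerivAt (fun z => (returnMap (q.1, z)).2) (fderiv ℝ returnMap q (0, 1)).2 q.2 :=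
    (HasFDerivAt.comp_hasDerivAt (l := returnMap) q.2 hF.hasFDerivAt h1).snd
  refine h2.unique (((hasDerivAt_depth q.2).neg.congr_deriv (by ring)).congr_of_eventuallyEq ?_)
  exact Eventually.of_forall fun z => by simp only [returnMap_of_le (q := (q.1, z)) hx, lowerLeg,
    Pi.neg_apply]

theorem arrivalDeriv_le (hx : 0.05 < q.1) : arrivalDeriv q.1 ≤ -1.2 := by
  have h1 := sin_min_pos hx
  rw [arrivalDeriv, div_le_iff₀ (by positivity)]
  linarith [Real.sin_sq_le_one (Real.pi * (min q.1 0.55 - 0.05))]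

theorem eucl_eq {v : ℝ × ℝ} {r : ℝ} (hr : 0 ≤ r) (h : v.1 ^ 2 + v.2 ^ 2 = r ^ 2) :
    eucl v = r := by rw [eucl, h, Real.sqrt_sq hr]

/-- Where `x > 0.05`, the rate of expansion along the horseshoe is `-arrivalDeriv x`, reduced on
the lower leg. -/
theorem returnMap_frame (hx : 0.05 < q.1) (hz : q.2 < 0.8) :
    eucl (fderiv ℝ returnMap q (1, 0)) = -arrivalDeriv q.1 *
      (1 - legLagDeriv (arrival q.1 - Real.pi * depth q.2)) ∧
    |det2 (fderiv ℝ returnMap q (1, 0)) (fderiv ℝ returnMap q (0, 1))| =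
      1 / 5 * eucl (fderiv ℝ returnMap q (1, 0)) := by
  have hc := depth_pos hz
  have hp := Real.pi_pos
  have hT : 0 < -arrivalDeriv q.1 := by linarith [arrivalDeriv_le hx]
  rw [fderiv_returnMap_fst hx hz, fderiv_returnMap_snd hx hz]
  have hv : arrival q.1 - Real.pi * depth q.2 = depth q.2 * (arrival q.1 / depth q.2 - Real.pi) := by
    field_simp
  rw [hv]
  -- From here the angle `ψ` alone decides between upper leg (`ψ ≤ 0`), arch (`0 ≤ ψ ≤ π`) and lower
  -- leg (`π ≤ ψ`).
  generalize arrival q.1 / depth q.2 = ψ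
  generalize arrivalDeriv q.1 = T at *
  rcases le_total ψ 0 with h0 | h0
  · have e : max 0 (min ψ Real.pi) = 0 := max_eq_left ((min_le_left _ _).trans h0)
    rw [legLagDeriv_of_nonpos (mul_nonpos_of_nonneg_of_nonpos hc.le (by linarith)), e,
      bendCos_of_nonpos h0, bendSin_of_nonpos h0, Real.sin_zero]
    have h1 : eucl (T * (1 + 0), -(T * 0)) = -T := eucl_eq hT.le (by ring)
    rw [h1, det2]
    refine ⟨by ring, ?_⟩
    rw [abs_eq (by linarith)]
    left; ring
  rcases le_total ψ Real.pi with h1 | h1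
  · have e : max 0 (min ψ Real.pi) = ψ := by rw [min_eq_left h1, max_eq_right h0]
    rw [legLagDeriv_of_nonpos (mul_nonpos_of_nonneg_of_nonpos hc.le (by linarith)), e,
      bendCos_of_mem ⟨h0, h1⟩, bendSin_of_mem ⟨h0, h1⟩]
    have hs := Real.sin_sq_add_cos_sq ψ
    have h2 : eucl (T * (Real.cos ψ + 0), -(T * Real.sin ψ)) = -T :=
      eucl_eq hT.le (by linear_combination T ^ 2 * hs)
    rw [h2, det2]
    refine ⟨by ring, ?_⟩
    rw [abs_eq (by linarith)]
    left; linear_combination -T / 5 * hs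
  · have e : max 0 (min ψ Real.pi) = Real.pi := by rw [min_eq_right h1, max_eq_right hp.le]
    rw [e, bendCos_of_ge h1, bendSin_of_ge h1, Real.sin_pi]
    have hl : 0 < 1 - legLagDeriv (depth q.2 * (ψ - Real.pi)) := by
      rw [legLagDeriv]
      have : 0 < 1 / (1 + (xiRate * max (depth q.2 * (ψ - Real.pi)) 0) ^ 2) := by positivity
      linarith
    generalize legLagDeriv (depth q.2 * (ψ - Real.pi)) = l at *
    have h2 : eucl (T * (-1 + l), -(T * 0)) = -T * (1 - l) :=
      eucl_eq (mul_nonneg hT.le hl.le) (by ring)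
    rw [h2, det2]
    refine ⟨rfl, ?_⟩
    rw [abs_eq (by have := mul_pos hT hl; linarith)]
    left; ring

theorem eucl_fderiv_returnMap_pos (hq : q ∈ returnDomain) :
    0 < eucl (fderiv ℝ returnMap q (1, 0)) ∧
    |det2 (fderiv ℝ returnMap q (1, 0)) (fderiv ℝ returnMap q (0, 1))| =
      1 / 5 * eucl (fderiv ℝ returnMap q (1, 0)) := by
  rcases le_or_gt q.1 0.05 with h | h
  · have hden := lowerLeg_denom_pos hq h
    have e2 := fderiv_returnMap_snd_snd_of_le hq h
    rw [fderiv_returnMap_fst_of_le hq h, det2, e2]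
    generalize Real.cos (Real.pi * (q.1 - 0.05)) -
      xiRate * Real.pi * depth q.2 * Real.sin (Real.pi * (q.1 - 0.05)) = a at *
    have hpos : 0 < 1.2 / (a ^ 2 + Real.sin (Real.pi * (q.1 - 0.05)) ^ 2) := by positivity
    generalize 1.2 / (a ^ 2 + Real.sin (Real.pi * (q.1 - 0.05)) ^ 2) = b at *
    have h1 : eucl (b, 0) = b := eucl_eq hpos.le (by ring)
    rw [h1]
    refine ⟨hpos, ?_⟩
    simp only
    rw [zero_mul, sub_zero, abs_of_pos (by positivity)]
    ring
  · obtain ⟨h1, h2⟩ := returnMap_frame h hq.2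
    refine ⟨?_, h2⟩
    rw [h1]
    refine mul_pos (by linarith [arrivalDeriv_le h]) ?_
    rw [legLagDeriv]
    have : 0 < 1 / (1 + (xiRate * max (arrival q.1 - Real.pi * depth q.2) 0) ^ 2) := by positivity
    linarith

/-- On the lower leg the rate is `1.2 / (s² (1 + (κ v)²))`, with `κ = xiRate`, `s = sin (π (x -
0.05))` and `v = T - πc ≤ T = arrival x`. As `κ T` is the cotangent, `s² (1 + (κ T)²) = 1`, so the
denominator is at most `1`. -/
theorem le_eucl_fderiv_returnMap (hq : q ∈ Q0) :
    1.2 ≤ eucl (fderiv ℝ returnMap q (1, 0)) := by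
  have hq' := Q0_subset_returnDomain hq
  have hk := xiRate_pos
  rcases hq.1.1.eq_or_lt with h | h
  · rw [fderiv_returnMap_fst_of_le hq' h.ge, ← h]
    rw [eucl_eq (r := 1.2) (by norm_num) (by norm_num)]
  · obtain ⟨h1, -⟩ := returnMap_frame h hq'.2
    have hT := arrivalDeriv_le h
    rw [h1]
    rcases le_total (arrival q.1 - Real.pi * depth q.2) 0 with h2 | h2
    · rw [legLagDeriv_of_nonpos h2]; linarith
    · have hc := mul_pos Real.pi_pos (depth_pos hq'.2)
      have h55 : q.1 ≤ 0.55 := by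
        by_contra! h3
        rw [arrival, if_neg (not_le.2 h3)] at h2
        linarith
      have hs := sin_pos_of_mem ⟨h, h55⟩
      have e : xiRate * arrival q.1 * Real.sin (Real.pi * (q.1 - 0.05)) =
          Real.cos (Real.pi * (q.1 - 0.05)) := by
        rw [arrival_of_le h55]; field_simp
      have hsc := Real.sin_sq_add_cos_sq (Real.pi * (q.1 - 0.05))
      rw [← e] at hsc
      rw [legLagDeriv, max_eq_left h2, arrivalDeriv, min_eq_left h55]
      set s := Real.sin (Real.pi * (q.1 - 0.05))
      have hv : (xiRate * (arrival q.1 - Real.pi * depth q.2)) ^ 2 ≤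
          (xiRate * arrival q.1) ^ 2 := by
        refine pow_le_pow_left₀ (mul_nonneg hk.le h2) ?_ 2
        exact mul_le_mul_of_nonneg_left (by linarith) hk.le
      have h3 : s ^ 2 * (1 + (xiRate * (arrival q.1 - Real.pi * depth q.2)) ^ 2) ≤ 1 := by
        nlinarith [sq_nonneg s]
      have h4 : 0 < s ^ 2 * (1 + (xiRate * (arrival q.1 - Real.pi * depth q.2)) ^ 2) := by
        positivity
      have h5 : -(-1.2 / s ^ 2) *
          (1 - (1 - 1 / (1 + (xiRate * (arrival q.1 - Real.pi * depth q.2)) ^ 2))) =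
          1.2 / (s ^ 2 * (1 + (xiRate * (arrival q.1 - Real.pi * depth q.2)) ^ 2)) := by
        field_simp
        ring
      rw [h5, le_div_iff₀ h4]
      linarith

end

/-! ### The inverse of the return map -/

/-- Cramer's rule for the homogeneous system. -/
theorem injective_of_det2_ne_zero {L : ℝ × ℝ →L[ℝ] ℝ × ℝ} (h : det2 (L (1, 0)) (L (0, 1)) ≠ 0) :
    Function.Injective L := by
  rw [injective_iff_map_eq_zero]
  intro v hv
  have e : v = v.1 • ((1 : ℝ), (0 : ℝ)) + v.2 • ((0 : ℝ), (1 : ℝ)) := by ext <;> simp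
  rw [e, map_add, map_smul, map_smul] at hv
  have h1 := congrArg Prod.fst hv
  have h2 := congrArg Prod.snd hv
  simp only [Prod.fst_add, Prod.snd_add, Prod.smul_fst, Prod.smul_snd, smul_eq_mul,
    Prod.fst_zero, Prod.snd_zero] at h1 h2
  unfold det2 at h
  ext
  · refine (mul_eq_zero.1 (?_ : v.1 * _ = 0)).resolve_right h
    linear_combination (L (0, 1)).2 * h1 - (L (0, 1)).1 * h2
  · refine (mul_eq_zero.1 (?_ : v.2 * _ = 0)).resolve_right h
    linear_combination (L (1, 0)).1 * h2 - (L (1, 0)).2 * h1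

/-- Near each image point the set-theoretic inverse equals the local inverse of the inverse function
theorem: the latter takes values in `V`, where `F` is injective. Hence the global inverse is `C¹`.
-/
theorem exists_contDiffOn_inverse {E : Type*} [NormedAddCommGroup E] [NormedSpace ℝ E]
    [FiniteDimensional ℝ E] {F : E → E} {V : Set E} (hV : IsOpen V)
    (hF : ∀ q ∈ V, ContDiffAt ℝ 1 F q) (hF' : ∀ q ∈ V, Function.Injective (fderiv ℝ F q))
    (hinj : InjOn F V) :
    ∃ G : E → E, ContDiffOn ℝ 1 G (F '' V) ∧ ∀ q ∈ V, G (F q) = q := by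
  have := FiniteDimensional.complete ℝ E
  rcases isEmpty_or_nonempty V with hem | hne
  · rw [isEmpty_coe_sort] at hem
    subst hem
    exact ⟨id, by simp [contDiffOn_empty]⟩
  have : Nonempty E := hne.map Subtype.val
  have hleft : ∀ q ∈ V, Function.invFunOn F V (F q) = q := fun q hq =>
    hinj.leftInvOn_invFunOn hq
  refine ⟨Function.invFunOn F V, ?_, hleft⟩
  rintro _ ⟨q, hq, rfl⟩
  let e : E ≃L[ℝ] E := (LinearEquiv.ofInjectiveEndo (fderiv ℝ F q : E →ₗ[ℝ] E)
    (hF' q hq)).toContinuousLinearEquiv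
  have he : HasFDerivAt F (e : E →L[ℝ] E) q := by
    have h1 := ((hF q hq).differentiableAt one_ne_zero).hasFDerivAt
    convert h1 using 1
    ext v
    rfl
  have hs : HasStrictFDerivAt F (e : E →L[ℝ] E) q := (hF q hq).hasStrictFDerivAt' he one_ne_zero
  refine ContDiffAt.contDiffWithinAt ?_
  refine ((hF q hq).to_localInverse he one_ne_zero).congr_of_eventuallyEq ?_
  have h1 : ∀ᶠ y in 𝓝 (F q), hs.localInverse F e q y ∈ V :=
    hs.localInverse_tendsto (hV.mem_nhds hq)
  filter_upwards [h1, hs.eventually_right_inverse] with y hy hy'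
  have := hleft _ hy
  rw [hy'] at this
  exact this

/-! ### The geometry of the return map -/

theorem arrival_of_ge {x : ℝ} (hx : 0.55 ≤ x) : arrival x = 1.2 * (0.55 - x) := by
  rcases hx.eq_or_lt with rfl | h
  · have h55 : Real.pi * (0.55 - 0.05) = Real.pi / 2 := by ring
    rw [arrival_of_le le_rfl, h55]
    simp
  · exact if_neg (not_le.2 h)

theorem strictAntiOn_arrival : StrictAntiOn arrival (Ioi 0.05) := by
  intro x hx y hy hxy
  have hk := xiRate_pos
  rcases le_or_gt y 0.55 with h | h
  · have e1 := arctan_arrival ⟨hx, hxy.le.trans h⟩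
    have e2 := arctan_arrival ⟨hy, h⟩
    have h1 : Real.arctan (xiRate * arrival y) < Real.arctan (xiRate * arrival x) := by
      rw [e1, e2]
      nlinarith [Real.pi_pos]
    exact lt_of_mul_lt_mul_left (Real.arctan_strictMono.lt_iff_lt.1 h1) hk.le
  · rw [arrival_of_ge h.le]
    rcases le_or_gt x 0.55 with h2 | h2
    · linarith [arrival_nonneg ⟨hx, h2⟩]
    · rw [arrival_of_ge h2.le]; linarith

theorem ge_of_arrival_nonpos {x : ℝ} (hx : 0.05 < x) (hT : arrival x ≤ 0) : 0.55 ≤ x := by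
  by_contra! h2
  have := strictAntiOn_arrival hx (show (0.05 : ℝ) < 0.55 by norm_num) h2
  rw [arrival_of_ge le_rfl] at this
  norm_num at this
  linarith

theorem le_of_arrival_nonneg {x : ℝ} (hT : 0 ≤ arrival x) : x ≤ 0.55 := by
  by_contra! h
  rw [arrival_of_ge h.le] at hT
  linarith

theorem exists_arrival_eq {v : ℝ} (hv : 0 ≤ v) : ∃ x ∈ Ioc (0.05 : ℝ) 0.55, arrival x = v := by
  have hk := xiRate_pos
  have hp := Real.pi_pos
  have h1 : 0 ≤ Real.arctan (xiRate * v) := Real.arctan_nonneg.2 (mul_nonneg hk.le hv)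
  have h2 := Real.arctan_lt_pi_div_two (xiRate * v)
  have hx : 0.05 + (Real.pi / 2 - Real.arctan (xiRate * v)) / Real.pi ∈ Ioc (0.05 : ℝ) 0.55 := by
    constructor
    · have : 0 < (Real.pi / 2 - Real.arctan (xiRate * v)) / Real.pi := div_pos (by linarith) hp
      linarith
    · have : (Real.pi / 2 - Real.arctan (xiRate * v)) / Real.pi ≤ 0.5 := by
        rw [div_le_iff₀ hp]; linarith
      linarith
  refine ⟨_, hx, ?_⟩
  have e := arctan_arrival hx
  have h3 : Real.arctan (xiRate * arrival (0.05 + (Real.pi / 2 - Real.arctan (xiRate * v)) /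
      Real.pi)) = Real.arctan (xiRate * v) := by
    rw [e]; field_simp; ring
  exact mul_left_cancel₀ hk.ne' (Real.arctan_injective h3)

section
variable {q : ℝ × ℝ}

theorem returnMap_left_mem (hq : q ∈ returnDomain) (hx : q.1 ≤ 0.05) :
    (returnMap q).1 ≤ 0.06 ∧ (returnMap q).2 = -depth q.2 := by
  have hp := Real.pi_pos
  rw [returnMap_of_le hx]
  refine ⟨?_, rfl⟩
  have h2 : Real.sin (Real.pi * (q.1 - 0.05)) ≤ 0 :=
    Real.sin_nonpos_of_nonpos_of_neg_pi_le (by nlinarith) (by nlinarith [hq.1])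
  have h3 := div_nonpos_of_nonpos_of_nonneg
    (Real.arctan_le_zero.2 (div_nonpos_of_nonpos_of_nonneg h2 (lowerLeg_denom_pos hq hx).le))
    xiRate_pos.le
  simp only [lowerLeg]
  linarith

theorem returnMap_leg_mem (hx : 0.05 < q.1) (hz : q.2 < 0.8)
    (hT : Real.pi * depth q.2 ≤ arrival q.1) :
    (returnMap q).1 ∈ Ioc 0.06 0.66 ∧ (returnMap q).2 = -depth q.2 := by
  rw [returnMap_leg hx hz hT]
  have h1 := (arctan_div_xiRate_mem (xiRate * (arrival q.1 - Real.pi * depth q.2))).2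
  have h2 : 0 ≤ Real.arctan (xiRate * (arrival q.1 - Real.pi * depth q.2)) / xiRate :=
    div_nonneg (Real.arctan_nonneg.2 (mul_nonneg xiRate_pos.le (by linarith))) xiRate_pos.le
  exact ⟨⟨by simp only; linarith, by simp only; linarith⟩, rfl⟩

theorem arch_angle_mem (hz : q.2 < 0.8) (hT : arrival q.1 ∈ Icc 0 (Real.pi * depth q.2)) :
    arrival q.1 / depth q.2 ∈ Icc 0 Real.pi := by
  have hc := depth_pos hz
  exact ⟨div_nonneg hT.1 hc.le, by rw [div_le_iff₀ hc]; exact hT.2⟩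

theorem returnMap_arch_mem (hx : 0.05 < q.1) (hz : q.2 < 0.8)
    (hT : arrival q.1 ∈ Icc 0 (Real.pi * depth q.2)) :
    0.66 ≤ (returnMap q).1 ∧
      ((returnMap q).1 - 0.66) ^ 2 + (returnMap q).2 ^ 2 = depth q.2 ^ 2 := by
  have hψ := arch_angle_mem hz hT
  rw [returnMap_arch hx hz hT]
  constructor
  · have := mul_nonneg (depth_pos hz).le (Real.sin_nonneg_of_nonneg_of_le_pi hψ.1 hψ.2)
    simp only
    linarith
  · simp only
    linear_combination depth q.2 ^ 2 * Real.sin_sq_add_cos_sq (arrival q.1 / depth q.2)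

theorem depth_injective : Function.Injective depth := fun a b h => by
  unfold depth at h; linarith

theorem injOn_returnMap : InjOn returnMap returnDomain := by
  -- the pieces have disjoint images, and are injective separately
  have hk := xiRate_pos
  have hp := Real.pi_pos
  have key : ∀ q ∈ returnDomain, ∀ q' ∈ returnDomain, q.1 ≤ q'.1 →
      returnMap q = returnMap q' → q = q' := by
    intro q hq q' hq' hle h
    have hc := depth_pos hq.2
    have hc' := depth_pos hq'.2
    have hcp := mul_pos hp hc
    have hcp' := mul_pos hp hc'
    have cases : ∀ p ∈ returnDomain, p.1 ≤ 0.05 ∨ (0.05 < p.1 ∧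
        (Real.pi * depth p.2 < arrival p.1 ∨ arrival p.1 ∈ Icc 0 (Real.pi * depth p.2) ∨
          arrival p.1 < 0)) := by
      intro p _
      rcases le_or_gt p.1 0.05 with h1 | h1
      · exact Or.inl h1
      refine Or.inr ⟨h1, ?_⟩
      rcases lt_or_ge (arrival p.1) 0 with h2 | h2
      · exact Or.inr (Or.inr h2)
      rcases lt_or_ge (Real.pi * depth p.2) (arrival p.1) with h3 | h3
      · exact Or.inl h3
      · exact Or.inr (Or.inl ⟨h2, h3⟩)
    have legLt : ∀ p ∈ returnDomain, 0.05 < p.1 → Real.pi * depth p.2 < arrival p.1 →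
        (returnMap p).1 < 0.66 := by
      intro p hp' h1 h2
      rw [returnMap_leg h1 hp'.2 h2.le]
      have := div_pos (Real.arctan_pos.2 (mul_pos hk (by linarith :
        0 < arrival p.1 - Real.pi * depth p.2))) hk
      simp only
      linarith
    have finish : 0.05 < q.1 → 0.05 < q'.1 → depth q.2 = depth q'.2 →
        arrival q.1 = arrival q'.1 → q = q' := fun h1 h2 h3 h4 =>
      Prod.ext (strictAntiOn_arrival.injOn h1 h2 h4) (depth_injective h3)
    have e1 := congrArg Prod.fst h
    have e2 := congrArg Prod.snd h
    rcases cases q hq with h1 | ⟨h1, h2⟩ <;> rcases cases q' hq' with h1' | ⟨h1', h2'⟩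
    · have hz : q.2 = q'.2 := depth_injective (by
        rw [(returnMap_left_mem hq h1).2, (returnMap_left_mem hq' h1').2] at e2
        linarith)
      refine Prod.ext ?_ hz
      rw [returnMap_of_le h1, returnMap_of_le h1'] at e1
      have d := (lowerLeg_denom_pos hq h1).ne'
      have d' := (lowerLeg_denom_pos hq' h1').ne'
      simp only [lowerLeg, ← hz] at e1 d'
      have e3 := Real.arctan_injective ((div_left_inj' hk.ne').1 (add_left_cancel e1))
      rw [div_eq_div_iff d d'] at e3
      -- After cross-multiplication the terms containing the common depth cancel, leaving the sine
      -- of the difference of two angles in `(-π / 2, 0]`.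
      have e4 : Real.sin (Real.pi * (q.1 - 0.05) - Real.pi * (q'.1 - 0.05)) = 0 := by
        rw [Real.sin_sub]
        linear_combination e3
      have e5 := (Real.sin_eq_zero_iff_of_lt_of_lt (by nlinarith [hq.1]) (by nlinarith)).1 e4
      have e6 := mul_left_cancel₀ hp.ne' (sub_eq_zero.1 e5)
      linarith
    · exfalso
      have a := returnMap_left_mem hq h1
      rcases h2' with h2' | h2' | h2'
      · linarith [(returnMap_leg_mem h1' hq'.2 h2'.le).1.1]
      · linarith [(returnMap_arch_mem h1' hq'.2 h2').1]
      · rw [returnMap_upper h1' hq'.2 h2'.le] at e2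
        simp only at e2
        linarith
    · linarith
    · rcases h2 with h2 | h2 | h2 <;> rcases h2' with h2' | h2' | h2'
      · rw [returnMap_leg h1 hq.2 h2.le, returnMap_leg h1' hq'.2 h2'.le] at e1 e2
        simp only [neg_inj] at e1 e2
        have e3 := Real.arctan_injective ((div_left_inj' hk.ne').1 (sub_right_injective e1))
        have e4 := mul_left_cancel₀ hk.ne' e3
        rw [e2] at e4
        exact finish h1 h1' e2 (by linarith)
      · linarith [legLt q hq h1 h2, (returnMap_arch_mem h1' hq'.2 h2').1]
      · rw [(returnMap_leg_mem h1 hq.2 h2.le).2, returnMap_upper h1' hq'.2 h2'.le] at e2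
        simp only at e2
        linarith
      · linarith [legLt q' hq' h1' h2', (returnMap_arch_mem h1 hq.2 h2).1]
      -- On the arch the distance to the centre `(0.66, 0)` is the depth, so it can be recovered
      -- from the image.
      · have hcc : depth q.2 = depth q'.2 := by
          have a := (returnMap_arch_mem h1 hq.2 h2).2
          have a' := (returnMap_arch_mem h1' hq'.2 h2').2
          rw [h, a'] at a
          exact ((pow_left_inj₀ hc'.le hc.le two_ne_zero).1 a).symm
        have b := arch_angle_mem hq.2 h2
        have b' := arch_angle_mem hq'.2 h2'
        rw [returnMap_arch h1 hq.2 h2, returnMap_arch h1' hq'.2 h2'] at e2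
        simp only [← hcc] at e2 b'
        have e3 := Real.injOn_cos b b' (mul_left_cancel₀ hc.ne' e2)
        exact finish h1 h1' hcc ((div_left_inj' hc.ne').1 e3)
      · have := (returnMap_arch_mem h1 hq.2 h2).1
        rw [h, returnMap_upper h1' hq'.2 h2'.le] at this
        simp only at this
        linarith
      · rw [(returnMap_leg_mem h1' hq'.2 h2'.le).2, returnMap_upper h1 hq.2 h2.le] at e2
        simp only at e2
        linarith
      · have := (returnMap_arch_mem h1' hq'.2 h2').1
        rw [← h, returnMap_upper h1 hq.2 h2.le] at this
        simp only at this
        linarith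
      · rw [returnMap_upper h1 hq.2 h2.le, returnMap_upper h1' hq'.2 h2'.le] at e1 e2
        simp only at e1 e2
        exact finish h1 h1' e2 (by linarith)
  intro q hq q' hq' h
  rcases le_total q.1 q'.1 with h1 | h1
  · exact key q hq q' hq' h1 h
  · exact (key q' hq' q hq h1 h.symm).symm

/-- At the end of the fold the angle turned since arrival is `π - ψ`, with `ψ = arrival x / c`;
supplementary angles give the arch formula in `ψ`. -/
theorem foldCurve_pi_eq_returnMap (hq : q ∈ Q0) :
    foldCurve q.1 (depth q.2) Real.pi = returnMap q := by
  have hz : q.2 < 0.8 := (Q0_subset_returnDomain hq).2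
  have hc := depth_pos hz
  have hk := xiRate_pos
  rcases hq.1.1.eq_or_lt with h | h
  · rw [foldCurve_of_le h.ge, returnMap_of_le h.ge, lowerLeg, ← h]
    simp
  rcases le_or_gt q.1 0.55 with h1 | h1
  · have hT := arrival_nonneg ⟨h, h1⟩
    rw [foldCurve_of_mem ⟨h, h1⟩]
    rcases le_total (Real.pi * depth q.2) (arrival q.1) with h2 | h2
    · rw [returnMap_leg h hz h2, legArch_of_nonpos (sub_nonpos.2 (by rwa [le_div_iff₀ hc]))]
      have : xiRate * depth q.2 * (Real.pi - arrival q.1 / depth q.2) =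
          -(xiRate * (arrival q.1 - Real.pi * depth q.2)) := by field_simp; ring
      rw [this, Real.arctan_neg, neg_div, ← sub_eq_add_neg]
    · rw [returnMap_arch h hz ⟨hT, h2⟩, legArch_of_nonneg (sub_nonneg.2 (by rwa [div_le_iff₀ hc])),
        Real.sin_pi_sub, Real.cos_pi_sub]
      ext <;> simp
  · rw [foldCurve_of_lt h1, returnMap_upper h hz (by rw [arrival_of_ge h1.le]; linarith),
      arrival_of_ge h1.le]
    ext
    · simp; ring
    · simp

/-- The image of `Q₀`: an arch to the right of `x = 0.66` and two legs to the left. -/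
theorem image_returnMap : returnMap '' Q0 =
    {y | 0.66 ≤ y.1 ∧ (y.1 - 0.66) ^ 2 + y.2 ^ 2 ∈ Icc (0.06 ^ 2 : ℝ) (0.26 ^ 2)} ∪
      {y | y.1 ∈ Icc 0.06 0.66 ∧ |y.2| ∈ Icc (0.06 : ℝ) 0.26} := by
  have hk := xiRate_pos
  apply Subset.antisymm
  · rintro _ ⟨q, hq, rfl⟩
    have hz : q.2 < 0.8 := (Q0_subset_returnDomain hq).2
    have hc := depth_pos hz
    have hc' := depth_mem hq.2
    have leg : |-depth q.2| ∈ Icc (0.06 : ℝ) 0.26 := by rwa [abs_neg, abs_of_pos hc]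
    rcases hq.1.1.eq_or_lt with h | h
    · right
      rw [returnMap_of_le h.ge, lowerLeg, ← h]
      refine ⟨?_, leg⟩
      simp; norm_num
    rcases le_total (arrival q.1) 0 with h1 | h1
    · right
      have h55 := ge_of_arrival_nonpos h h1
      rw [returnMap_upper h hz h1, arrival_of_ge h55]
      refine ⟨⟨?_, ?_⟩, by rwa [abs_of_pos hc]⟩
      · simp only; linarith [hq.1.2]
      · simp only; linarith
    rcases le_total (Real.pi * depth q.2) (arrival q.1) with h2 | h2
    · right
      have := returnMap_leg_mem h hz h2
      refine ⟨Ioc_subset_Icc_self this.1, ?_⟩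
      rw [this.2]
      exact leg
    · left
      have := returnMap_arch_mem h hz ⟨h1, h2⟩
      refine ⟨this.1, ?_⟩
      rw [this.2]
      exact ⟨pow_le_pow_left₀ (by norm_num) hc'.1 2, pow_le_pow_left₀ hc.le hc'.2 2⟩
  · have mem : ∀ x c : ℝ, x ∈ Icc (0.05 : ℝ) 1.05 → c ∈ Icc (0.06 : ℝ) 0.26 →
        (x, 5 * (0.16 - c)) ∈ Q0 ∧ depth (5 * (0.16 - c)) = c := fun x c hx hc =>
      ⟨⟨hx, by constructor <;> linarith [hc.1, hc.2]⟩, by unfold depth; ring⟩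
    rintro y (⟨h1, h2⟩ | ⟨h1, h2⟩)
    · obtain ⟨c, hc, hcy⟩ : ∃ c ∈ Icc (0.06 : ℝ) 0.26, (y.1 - 0.66) ^ 2 + y.2 ^ 2 = c ^ 2 :=
        ⟨√((y.1 - 0.66) ^ 2 + y.2 ^ 2), ⟨Real.le_sqrt_of_sq_le h2.1,
          Real.sqrt_le_iff.2 ⟨by norm_num, h2.2⟩⟩, (Real.sq_sqrt (by positivity)).symm⟩
      have hc0 : 0 < c := by linarith [hc.1]
      have hy2 : |y.2| ≤ c := abs_le_of_sq_le_sq (by nlinarith [sq_nonneg (y.1 - 0.66)]) hc0.le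
      have b1 : -1 ≤ y.2 / c := by rw [le_div_iff₀ hc0]; linarith [(abs_le.1 hy2).1]
      have b2 : y.2 / c ≤ 1 := by rw [div_le_iff₀ hc0]; linarith [(abs_le.1 hy2).2]
      -- In polar coordinates about `(0.66, 0)` the radius fixes `z`, and the angle from the upward
      -- vertical, times the radius, is the arrival value that fixes `x`.
      obtain ⟨x, hx, hTx⟩ := exists_arrival_eq
        (mul_nonneg hc0.le (Real.arccos_nonneg (y.2 / c)))
      obtain ⟨m1, m2⟩ := mem x c ⟨hx.1.le, by linarith [hx.2]⟩ hc
      refine ⟨_, m1, ?_⟩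
      rw [returnMap_arch hx.1 (Q0_subset_returnDomain m1).2]
      · simp only [m2, hTx]
        rw [mul_div_cancel_left₀ _ hc0.ne', Real.cos_arccos b1 b2, Real.sin_arccos,
          mul_div_cancel₀ _ hc0.ne']
        have : c * √(1 - (y.2 / c) ^ 2) = y.1 - 0.66 := by
          have e : 1 - (y.2 / c) ^ 2 = ((y.1 - 0.66) / c) ^ 2 := by
            field_simp; linarith
          rw [e, Real.sqrt_sq (div_nonneg (by linarith) hc0.le), mul_div_cancel₀ _ hc0.ne']
        rw [this]
        ext <;> simp
      · simp only [m2, hTx]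
        refine ⟨mul_nonneg hc0.le (Real.arccos_nonneg _), ?_⟩
        rw [mul_comm]
        exact mul_le_mul_of_nonneg_right (Real.arccos_le_pi _) hc0.le
    · rcases le_total 0 y.2 with h3 | h3
      · rw [abs_of_nonneg h3] at h2
        obtain ⟨x, hx⟩ : ∃ x, y.1 = 0.66 + 1.2 * (0.55 - x) :=
          ⟨0.55 + (0.66 - y.1) / 1.2, by ring⟩
        rw [hx] at h1
        have hT : arrival x = y.1 - 0.66 := by
          rw [arrival_of_ge (by linarith [h1.2]), hx]; ring
        obtain ⟨m1, m2⟩ := mem x y.2 (by constructor <;> linarith [h1.1, h1.2]) h2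
        refine ⟨_, m1, ?_⟩
        rw [returnMap_upper _ (Q0_subset_returnDomain m1).2]
        · simp only [m2, hT]
          ext <;> simp
        · simp only [hT]; linarith [h1.2]
        · simp only; linarith [h1.2]
      · rw [abs_of_nonpos h3] at h2
        rcases h1.1.eq_or_lt with h4 | h4
        · obtain ⟨m1, m2⟩ := mem 0.05 (-y.2) (by norm_num) h2
          refine ⟨_, m1, ?_⟩
          rw [returnMap_of_le le_rfl, lowerLeg]
          simp only [m2]
          ext
          · simp [h4]
          · simp
        · have e : Real.pi / 2 = 0.6 * xiRate := by unfold xiRate; ring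
          have t1 : xiRate * (0.66 - y.1) < Real.pi / 2 := by rw [e]; nlinarith
          have t0 : 0 ≤ xiRate * (0.66 - y.1) := mul_nonneg hk.le (by linarith [h1.2])
          have htan := Real.tan_nonneg_of_nonneg_of_le_pi_div_two t0 t1.le
          have hpc := mul_nonneg Real.pi_pos.le (by linarith : 0 ≤ -y.2)
          -- The value `tan (xiRate * (0.66 - y.1)) / xiRate + π c` solves the lower leg formula for
          -- the arrival value.
          obtain ⟨x, hx, hTx⟩ := exists_arrival_eq
            (add_nonneg (div_nonneg htan hk.le) hpc)
          obtain ⟨m1, m2⟩ := mem x (-y.2) ⟨hx.1.le, by linarith [hx.2]⟩ h2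
          refine ⟨_, m1, ?_⟩
          rw [returnMap_leg hx.1 (Q0_subset_returnDomain m1).2]
          · simp only [m2, hTx, add_sub_cancel_right]
            rw [mul_div_cancel₀ _ hk.ne', Real.arctan_tan (by linarith) t1,
              mul_div_cancel_left₀ _ hk.ne']
            ext <;> simp
          · simp only [m2, hTx]
            linarith [div_nonneg htan hk.le]

end

/-! ### The generalized attracting horseshoe -/

section
variable {q : ℝ × ℝ}

theorem image_returnMap_subset {y : ℝ × ℝ} (hy : y ∈ returnMap '' Q0) :
    y.1 ∈ Icc (0.06 : ℝ) 0.92 ∧ |y.2| ≤ 0.26 := by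
  rw [image_returnMap] at hy
  rcases hy with ⟨h1, h2⟩ | ⟨h1, h2⟩
  · have a := abs_le_of_sq_le_sq' (by nlinarith [h2.2, sq_nonneg y.2] :
      (y.1 - 0.66) ^ 2 ≤ 0.26 ^ 2) (by norm_num)
    refine ⟨⟨by linarith, by linarith [a.2]⟩, abs_le_of_sq_le_sq ?_ (by norm_num)⟩
    nlinarith [h2.2, sq_nonneg (y.1 - 0.66)]
  · exact ⟨⟨h1.1, by linarith [h1.2]⟩, h2.2⟩

theorem mapsTo_returnMap : MapsTo returnMap Q0 (interior Q0) := by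
  intro q hq
  obtain ⟨h1, h2⟩ := image_returnMap_subset (mem_image_of_mem _ hq)
  rw [Q0, rect, interior_prod_eq, interior_Icc, interior_Icc]
  have := abs_le.1 h2
  refine ⟨⟨?_, ?_⟩, ⟨?_, ?_⟩⟩ <;> linarith [h1.1, h1.2]

theorem image_returnMap_subset_Q0 : returnMap '' Q0 ⊆ Q0 := by
  rintro _ ⟨q, hq, rfl⟩
  exact interior_subset (mapsTo_returnMap hq)

theorem fderivWithin_returnMap (hq : q ∈ Q0) :
    fderivWithin ℝ returnMap Q0 q = fderiv ℝ returnMap q :=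
  (differentiableAt_returnMap (Q0_subset_returnDomain hq)).fderivWithin
    (((uniqueDiffOn_Icc (by norm_num)).prod (uniqueDiffOn_Icc (by norm_num))) q hq)

theorem isC1DiffeoOn_returnMap : IsC1DiffeoOn returnMap Q0 := by
  refine ⟨fun q hq => (contDiffAt_returnMap (Q0_subset_returnDomain hq)).contDiffWithinAt, ?_⟩
  have hdet : ∀ q ∈ returnDomain,
      det2 (fderiv ℝ returnMap q (1, 0)) (fderiv ℝ returnMap q (0, 1)) ≠ 0 := by
    intro q hq
    obtain ⟨h1, h2⟩ := eucl_fderiv_returnMap_pos hq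
    rw [← abs_pos, h2]
    positivity
  obtain ⟨G, hG, hGF⟩ := exists_contDiffOn_inverse isOpen_returnDomain
    (fun q hq => contDiffAt_returnMap hq) (fun q hq => injective_of_det2_ne_zero (hdet q hq))
    injOn_returnMap
  exact ⟨G, hG.mono (image_mono Q0_subset_returnDomain),
    fun q hq => hGF q (Q0_subset_returnDomain hq)⟩

theorem returnMap_of_ge (hx : 0.55 ≤ q.1) (hz : q.2 < 0.8) :
    returnMap q = (1.32 - 1.2 * q.1, depth q.2) := by
  rw [returnMap_upper (by linarith) hz (by rw [arrival_of_ge hx]; linarith), arrival_of_ge hx]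
  ext
  · simp only; ring
  · rfl

/-- The pieces of a horizontal segment meet where `arrival` equals `πc` and `0`. The second point is
always `x = 0.55`, and the line `z = 0` separates the legs at heights `-c` and `c`. -/
theorem foldsToHorseshoe_returnMap :
    FoldsToHorseshoe returnMap 0.05 1.05 (-0.5) 0.5 0.66 := by
  have hk := xiRate_pos
  refine ⟨1, 0, Or.inl rfl, fun z hz => ?_⟩
  have hz8 : z < 0.8 := by linarith [hz.2]
  have hc := depth_pos hz8
  have hpc := mul_pos Real.pi_pos hc
  obtain ⟨α, hα, hTα⟩ := exists_arrival_eq hpc.le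
  have hα55 : α < 0.55 := by
    refine lt_of_le_of_ne hα.2 fun h => ?_
    rw [h, arrival_of_ge le_rfl, sub_self, mul_zero] at hTα
    exact hpc.ne hTα
  have hdom : ∀ x ∈ Icc (0.05 : ℝ) 1.05, (x, z) ∈ returnDomain := fun x hx =>
    Q0_subset_returnDomain ⟨hx, hz⟩
  have h55 : arrival 0.55 = 0 := by rw [arrival_of_ge le_rfl]; ring
  have leg : ∀ x ∈ Ioc 0.05 α, Real.pi * depth z ≤ arrival x := fun x hx => by
    rw [← hTα]
    exact strictAntiOn_arrival.antitoneOn hx.1 hα.1 hx.2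
  have arch : ∀ x ∈ Icc α 0.55, arrival x ∈ Icc 0 (Real.pi * depth z) := fun x hx => by
    rw [← hTα, ← h55]
    have h1 : 0.05 < x := hα.1.trans_le hx.1
    exact ⟨strictAntiOn_arrival.antitoneOn h1 (by norm_num : (0.05 : ℝ) < 0.55) hx.2,
      strictAntiOn_arrival.antitoneOn hα.1 h1 hx.1⟩
  refine ⟨α, 0.55, hα.1, hα55, by norm_num, ?_, ?_, ?_, ?_, ?_, ?_⟩
  · intro x hx y hy hxy
    have hy1 : 0.05 < y := hx.1.trans_lt hxy
    simp only
    rcases hx.1.eq_or_lt with h | h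
    · have a := (returnMap_left_mem (q := (x, z)) (hdom x ⟨hx.1, by linarith [hx.2]⟩) h.ge).1
      have b := (returnMap_leg_mem (q := (y, z)) hy1 hz8 (leg y ⟨hy1, hy.2⟩)).1.1
      linarith
    · rw [returnMap_leg (q := (x, z)) h hz8 (leg x ⟨h, hx.2⟩),
        returnMap_leg (q := (y, z)) hy1 hz8 (leg y ⟨hy1, hy.2⟩)]
      have a := strictAntiOn_arrival h hy1 hxy
      have b := div_lt_div_of_pos_right (Real.arctan_strictMono (mul_lt_mul_of_pos_left
        (sub_lt_sub_right a (Real.pi * depth z)) hk)) hk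
      simp only
      linarith
  · intro x hx
    rcases hx.1.eq_or_lt with h | h
    · have a := returnMap_left_mem (q := (x, z)) (hdom x ⟨hx.1, by linarith [hx.2]⟩) h.ge
      rw [a.2]
      exact ⟨by linarith [a.1], by simp only; linarith⟩
    · have a := returnMap_leg_mem (q := (x, z)) h hz8 (leg x ⟨h, hx.2⟩)
      rw [a.2]
      exact ⟨a.1.2, by simp only; linarith⟩
  · intro x hx y hy hxy
    have hx1 : 0.05 < x := hα.1.trans_le hx.1
    have hy1 : 0.05 < y := hα.1.trans_le hy.1
    have ax := arch_angle_mem (q := (x, z)) hz8 (arch x hx)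
    have ay := arch_angle_mem (q := (y, z)) hz8 (arch y hy)
    simp only
    rw [returnMap_arch (q := (x, z)) hx1 hz8 (arch x hx),
      returnMap_arch (q := (y, z)) hy1 hz8 (arch y hy), one_mul, one_mul]
    exact mul_lt_mul_of_pos_left (Real.strictAntiOn_cos ay ax
      (div_lt_div_of_pos_right (strictAntiOn_arrival hx1 hy1 hxy) hc)) hc
  · intro x hx
    exact (returnMap_arch_mem (q := (x, z)) (hα.1.trans_le hx.1) hz8 (arch x hx)).1
  · intro x hx y hy hxy
    simp only
    rw [returnMap_of_ge (q := (x, z)) hx.1 hz8, returnMap_of_ge (q := (y, z)) hy.1 hz8]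
    simp only
    linarith
  · intro x hx
    rw [returnMap_of_ge (q := (x, z)) hx.1 hz8]
    simp only
    exact ⟨by linarith [hx.1], by linarith⟩

/-! ### The saddle and its stable segment -/

theorem returnMap_saddle : returnMap (0.6, 2 / 15) = (0.6, 2 / 15) := by
  rw [returnMap_of_ge (by norm_num) (by norm_num), depth]
  norm_num

theorem saddle_mem_Q0 : ((0.6, 2 / 15) : ℝ × ℝ) ∈ Q0 := by
  refine ⟨⟨?_, ?_⟩, ?_, ?_⟩ <;> norm_num

/-- The affine part has one fixed point. On the lower leg points move strictly to the right, the
image having abscissa above `1.2 x`; the arch has abscissa at least `0.66` but comes from `x ≤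
0.55`. -/
theorem fixedPoints_returnMap : {q ∈ Q0 | returnMap q = q} = {((0.6, 2 / 15) : ℝ × ℝ)} := by
  have hk := xiRate_pos
  refine Subset.antisymm ?_ (singleton_subset_iff.2 ⟨saddle_mem_Q0, returnMap_saddle⟩)
  rintro q ⟨hq, hfix⟩
  have hz : q.2 < 0.8 := (Q0_subset_returnDomain hq).2
  have hpc := mul_pos Real.pi_pos (depth_pos hz)
  have h1 : 0.05 < q.1 := by
    have := (image_returnMap_subset (mem_image_of_mem _ hq)).1.1
    rw [hfix] at this
    linarith
  rcases le_total (arrival q.1) 0 with h2 | h2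
  · rw [returnMap_of_ge (ge_of_arrival_nonpos h1 h2) hz, depth] at hfix
    have e1 := congrArg Prod.fst hfix
    have e2 := congrArg Prod.snd hfix
    simp only at e1 e2
    exact Prod.ext (by simp only; linarith) (by simp only; linarith)
  have h55 := le_of_arrival_nonneg h2
  exfalso
  rcases le_total (Real.pi * depth q.2) (arrival q.1) with h3 | h3
  · rw [returnMap_leg h1 hz h3] at hfix
    have e1 := congrArg Prod.fst hfix
    have a := Real.arctan_strictMono (mul_lt_mul_of_pos_left
      (sub_lt_self (arrival q.1) hpc) hk)
    rw [arctan_arrival ⟨h1, h55⟩] at a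
    have e : Real.pi = 1.2 * xiRate := by unfold xiRate; ring
    have b := div_lt_div_of_pos_right a hk
    have c : (Real.pi / 2 - Real.pi * (q.1 - 0.05)) / xiRate = 0.66 - 1.2 * q.1 := by
      rw [e]; field_simp; ring
    simp only at e1
    linarith
  · have := (returnMap_arch_mem h1 hz ⟨h2, h3⟩).1
    rw [hfix] at this
    linarith

theorem isSaddle_fderiv_returnMap : IsSaddle (fderiv ℝ returnMap (0.6, 2 / 15)) := by
  have hx : 0.05 < ((0.6, 2 / 15) : ℝ × ℝ).1 := by norm_num
  have hz : ((0.6, 2 / 15) : ℝ × ℝ).2 < 0.8 := by norm_num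
  have hc := depth_pos hz
  have hT : arrival ((0.6, 2 / 15) : ℝ × ℝ).1 ≤ 0 := by
    rw [arrival_of_ge (by norm_num)]; norm_num
  have hψ := div_nonpos_of_nonpos_of_nonneg hT hc.le
  have e0 := max_eq_left ((min_le_left _ Real.pi).trans hψ)
  have e1 := fderiv_returnMap_fst hx hz
  have e2 := fderiv_returnMap_snd hx hz
  rw [e0, bendCos_of_nonpos hψ, legLagDeriv_of_nonpos
    (by linarith [mul_pos Real.pi_pos hc]), Real.sin_zero] at e1 e2
  rw [bendSin_of_nonpos hψ] at e2
  have hd : arrivalDeriv ((0.6, 2 / 15) : ℝ × ℝ).1 = -1.2 := by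
    rw [arrivalDeriv, min_eq_right (by norm_num),
      show Real.pi * (0.55 - 0.05) = Real.pi / 2 by ring, Real.sin_pi_div_two]
    norm_num
  refine ⟨-1 / 5, -1.2, (0, 1), (1, 0), by simp, by simp, ?_, ?_, by norm_num, by norm_num,
    by norm_num⟩
  · rw [e2]
    ext
    · simp only [Prod.smul_mk, smul_eq_mul]; ring
    · simp only [Prod.smul_mk, smul_eq_mul]; ring
  · rw [e1, hd]
    ext
    · simp only [Prod.smul_mk, smul_eq_mul]; ring
    · simp only [Prod.smul_mk, smul_eq_mul]; ring

theorem iterate_returnMap {y : ℝ} (hy : y ∈ Icc (0.06 : ℝ) 0.26) (n : ℕ) :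
    returnMap^[n] (0.6, y) = (0.6, 2 / 15 + (-1 / 5) ^ n * (y - 2 / 15)) := by
  induction n with
  | zero => simp
  | succ n ih =>
    have h1 : |(-1 / 5 : ℝ) ^ n * (y - 2 / 15)| ≤ 1 * 0.2 := by
      rw [abs_mul, abs_pow]
      refine mul_le_mul (pow_le_one₀ (abs_nonneg _) ?_) ?_ (abs_nonneg _) zero_le_one
      · rw [abs_le]; norm_num
      · rw [abs_le]; constructor <;> linarith [hy.1, hy.2]
    rw [Function.iterate_succ_apply', ih, returnMap_of_ge (by norm_num)
      (by simp only; linarith [(abs_le.1 h1).2]), depth]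
    ext
    · norm_num
    · simp only [pow_succ]; ring

theorem mem_stableSet {y : ℝ} (hy : y ∈ Icc (0.06 : ℝ) 0.26) :
    ((0.6, y) : ℝ × ℝ) ∈ stableSet returnMap Q0 (0.6, 2 / 15) := by
  refine ⟨⟨by constructor <;> norm_num, ?_⟩, ?_⟩
  · constructor <;> simp only <;> linarith [hy.1, hy.2]
  · simp only [iterate_returnMap hy]
    refine Tendsto.prodMk_nhds tendsto_const_nhds ?_
    have h := tendsto_pow_atTop_nhds_zero_of_abs_lt_one
      (show |(-1 / 5 : ℝ)| < 1 by rw [abs_lt]; norm_num)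
    simpa using (h.mul_const (y - 2 / 15)).const_add (2 / 15)

theorem mem_image_returnMap {y : ℝ} (hy : y ∈ Icc (0.06 : ℝ) 0.26) :
    ((0.6, y) : ℝ × ℝ) ∈ returnMap '' Q0 := by
  rw [image_returnMap]
  right
  refine ⟨by constructor <;> norm_num, ?_⟩
  rw [abs_of_nonneg (by simp only; linarith [hy.1])]
  exact hy

/-- It suffices to leave the image along a vertical ray; `s` is the direction. -/
theorem mem_frontier_image {y s : ℝ} (hy : y ∈ Icc (0.06 : ℝ) 0.26)
    (hs : ∀ᶠ h in 𝓝[>] (0 : ℝ), ((0.6, y + h * s) : ℝ × ℝ) ∉ returnMap '' Q0) :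
    ((0.6, y) : ℝ × ℝ) ∈ frontier (returnMap '' Q0) := by
  refine ⟨subset_closure (mem_image_returnMap hy), fun hint => ?_⟩
  have hcont : ContinuousAt (fun h : ℝ => ((0.6, y + h * s) : ℝ × ℝ)) 0 := by fun_prop
  have h1 : ∀ᶠ h in 𝓝 (0 : ℝ), ((0.6, y + h * s) : ℝ × ℝ) ∈ returnMap '' Q0 :=
    hcont (by simpa using mem_interior_iff_mem_nhds.1 hint)
  obtain ⟨h, ha, hb⟩ := (hs.and (h1.filter_mono nhdsWithin_le_nhds)).exists
  exact ha hb

theorem abs_height_mem_of_lt {y : ℝ × ℝ} (hy : y ∈ returnMap '' Q0) (h : y.1 < 0.66) :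
    |y.2| ∈ Icc (0.06 : ℝ) 0.26 := by
  rw [image_returnMap] at hy
  rcases hy with hy | hy
  · exact absurd hy.1 (not_le.2 h)
  · exact hy.2

theorem isGAH_returnMap : IsGAH returnMap 0.05 1.05 (-0.5) 0.5 0.66 (0.6, 2 / 15)
    (returnMap '' Q0 ∩ {q | 0.66 ≤ q.1}) := by
  have arch : returnMap '' Q0 ∩ {q | 0.66 ≤ q.1} ⊆
      rect ((0.6, 2 / 15) : ℝ × ℝ).1 1.05 (-0.5) 0.5 := by
    rintro y ⟨hy, hy'⟩
    have h := image_returnMap_subset_Q0 hy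
    refine ⟨⟨?_, h.1.2⟩, h.2⟩
    have : 0.66 ≤ y.1 := hy'
    simp only
    linarith
  constructor
  · exact isC1DiffeoOn_returnMap
  · exact mapsTo_returnMap
  · exact foldsToHorseshoe_returnMap
  · left
    exact (congrArg Set.ncard fixedPoints_returnMap).trans (ncard_singleton _)
  · intro q hq hfix
    have : q ∈ {q ∈ Q0 | returnMap q = q} := ⟨hq, hfix⟩
    rw [fixedPoints_returnMap, mem_singleton_iff] at this
    subst this
    rw [← Q0, fderivWithin_returnMap hq]
    exact isSaddle_fderiv_returnMap
  · exact ⟨saddle_mem_Q0, returnMap_saddle⟩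
  · exact arch
  · exact arch
  -- The cap is the whole arch; `(0.72, 0)` is the tip of its inner circle.
  · refine ⟨0.66, le_rfl, ⟨(0.66 + 0.06, 0), ?_, by norm_num⟩, subset_rfl⟩
    rw [← Q0, image_returnMap]
    left
    exact ⟨by norm_num, by constructor <;> norm_num⟩
  -- These rates hold on the whole square, inside the keystone region as well.
  · refine ⟨1.2, 1 / 5, by norm_num, by norm_num, by norm_num, fun q hq => ?_⟩
    have hq0 : q ∈ Q0 := hq.1
    rw [← Q0, fderivWithin_returnMap hq0]
    exact ⟨le_eucl_fderiv_returnMap hq0,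
      (eucl_fderiv_returnMap_pos (Q0_subset_returnDomain hq0)).2.le⟩
  -- The arc is the vertical segment through the saddle that crosses the upper leg; it is invariant
  -- because the map is affine and diagonal there.
  · refine ⟨fun _ => 0.6, 0.06, 0.26, continuousOn_const, by constructor <;> norm_num, rfl,
      fun y hy => ⟨mem_stableSet hy, mem_image_returnMap hy⟩, ?_, ?_, ?_⟩
    · refine mem_frontier_image (s := -1) (by constructor <;> norm_num) ?_
      filter_upwards [Ioo_mem_nhdsGT (show (0 : ℝ) < 0.06 by norm_num)] with h hh hmem
      have := (abs_height_mem_of_lt hmem (by norm_num)).1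
      simp only at this
      rw [abs_of_nonneg (by linarith [hh.2])] at this
      linarith [hh.1]
    · refine mem_frontier_image (s := 1) (by constructor <;> norm_num) ?_
      filter_upwards [self_mem_nhdsWithin] with h hh hmem
      have := (abs_height_mem_of_lt hmem (by norm_num)).2
      have h0 : 0 < h := hh
      simp only at this
      rw [abs_of_nonneg (by linarith)] at this
      linarith
    · rintro q ⟨hq, hq'⟩ y -
      have h := image_returnMap_subset_Q0 hq
      have h66 : 0.66 ≤ q.1 := hq'
      -- With `x ≥ 0.66` the image abscissa is at most `1.32 - 1.2 * 0.66 = 0.528 < 0.6`.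
      rw [returnMap_of_ge (by linarith) (by linarith [h.2.2])]
      simp only
      linarith

theorem image_returnMap_eq_halfTurn :
    returnMap '' Q0 = halfTurn '' horseshoeSet 0.44 0.6 0.06 0.26 := by
  have inv : Function.Involutive halfTurn := fun q => by simp [halfTurn]
  rw [image_returnMap, inv.image_eq_preimage_symm]
  ext y
  have e : (1.1 - y.1 - 0.44) ^ 2 + (-y.2) ^ 2 = (y.1 - 0.66) ^ 2 + y.2 ^ 2 := by ring
  simp only [horseshoeSet, halfTurn, mem_union, mem_ofPred_eq, mem_preimage, mem_Icc, abs_neg, e]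
  refine or_congr (and_congr ?_ Iff.rfl) ?_
  · constructor <;> intro h <;> linarith
  · constructor
    · rintro ⟨⟨h1, h2⟩, h3⟩
      exact ⟨by linarith, by linarith, h3⟩
    · rintro ⟨h1, h2, h3⟩
      exact ⟨⟨by linarith, by linarith⟩, h3⟩

end

/-! ### The main theorem -/

theorem cartVelocity_ne_zero {q : ℝ × ℝ} (hq : q ∈ Q0) : (cartVelocity (q.1, 0, q.2)).2.1 ≠ 0 := by
  have : 0 < q.1 := by linarith [hq.1.1]
  simpa [cartVelocity, cylField] using this.ne'

theorem image_half_turn : {x | ∃ q ∈ Q0, ∃ γ, IsOrbitFrom q γ (2 * Real.pi) ∧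
      x = toCart (γ Real.pi)} =
    {x : ℝ × ℝ × ℝ | x.1 ∈ Icc (-1.26) (-0.06) ∧ x.2.1 = 0 ∧ x.2.2 ∈ Icc (-0.26) (-0.06)} := by
  have hp := Real.pi_pos
  ext x
  constructor
  · rintro ⟨q, hq, γ, hγ, rfl⟩
    rw [hγ.eqOn_orbit hq le_rfl ⟨hp.le, by linarith⟩, orbit_of_le q le_rfl, stretchCurve_pi]
    simp only [toCart, Real.cos_pi, Real.sin_pi, mul_zero, mem_ofPred_eq]
    refine ⟨⟨?_, ?_⟩, trivial, ?_, ?_⟩ <;> linarith [hq.1.1, hq.1.2, hq.2.1, hq.2.2]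
  · rintro ⟨h1, h2, h3⟩
    have hq : ((-x.1 / 1.2, 5 * (x.2.2 + 0.2) - 0.2) : ℝ × ℝ) ∈ Q0 := by
      refine ⟨⟨?_, ?_⟩, ?_, ?_⟩
      · rw [le_div_iff₀ (by norm_num)]; linarith [h1.2]
      · rw [div_le_iff₀ (by norm_num)]; linarith [h1.1]
      · simp only; linarith [h3.1]
      · simp only; linarith [h3.2]
    refine ⟨_, hq, orbit _, isOrbitFrom_orbit hq, ?_⟩
    rw [orbit_of_le _ le_rfl, stretchCurve_pi]
    ext
    · simp only [toCart, Real.cos_pi]; ring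
    · simp only [toCart, Real.sin_pi, mul_zero, h2]
    · simp only [toCart]; ring

theorem isPoincareMap_returnMap : IsPoincareMap returnMap := fun q hq q' => by
  rw [← foldCurve_pi_eq_returnMap hq]
  refine isFirstReturn_iff hq ?_ q'
  rw [foldCurve_pi_eq_returnMap hq]
  exact interior_subset (mapsTo_returnMap hq)

theorem mainTheorem1 :
    -- `Q0` is transversal to the field
    (∀ q ∈ Q0, (cartVelocity (q.1, 0, q.2)).2.1 ≠ 0) ∧
    -- orbits from `Q0` exist and are unique for a full turn
    (∀ q ∈ Q0, ∃ γ, IsOrbitFrom q γ (2 * Real.pi) ∧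
      ∀ δ T, T ≤ 2 * Real.pi → IsOrbitFrom q δ T → EqOn δ γ (Icc 0 T)) ∧
    -- first half-turn: stretching and squeezing
    (∀ q ∈ Q0, ∀ γ, IsOrbitFrom q γ (2 * Real.pi) →
      (∀ t ∈ Icc 0 Real.pi, γ t =
        (q.1 * Real.exp (Real.log 1.2 / (2 * Real.pi) * (2 * t - Real.sin (2 * t))), t,
          -0.2 + (q.2 + 0.2) *
            Real.exp (Real.log 0.2 / (2 * Real.pi) * (2 * t - Real.sin (2 * t))))) ∧
      γ Real.pi = (1.2 * q.1, Real.pi, -0.2 + (q.2 + 0.2) / 5)) ∧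
    {x | ∃ q ∈ Q0, ∃ γ, IsOrbitFrom q γ (2 * Real.pi) ∧ x = toCart (γ Real.pi)} =
      {x : ℝ × ℝ × ℝ | x.1 ∈ Icc (-1.26) (-0.06) ∧ x.2.1 = 0 ∧ x.2.2 ∈ Icc (-0.26) (-0.06)} ∧
    -- second half-turn: folding by rotation about the circle `r = 0.66`, `z = 0`
    (∀ q ∈ Q0, ∀ γ, IsOrbitFrom q γ (2 * Real.pi) →
      ∀ t₀ ∈ Icc Real.pi (2 * Real.pi),
        ((0.66 ≤ (γ t₀).1 ∨ 0 ≤ (γ t₀).2.2) → ∀ t ∈ Icc t₀ (2 * Real.pi),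
          (γ t).1 - 0.66 = ((γ t₀).1 - 0.66) * Real.cos (foldAngle t - foldAngle t₀)
            - (γ t₀).2.2 * Real.sin (foldAngle t - foldAngle t₀) ∧
          (γ t).2.1 = t ∧
          (γ t).2.2 = ((γ t₀).1 - 0.66) * Real.sin (foldAngle t - foldAngle t₀)
            + (γ t₀).2.2 * Real.cos (foldAngle t - foldAngle t₀)) ∧
        ((γ t₀).1 < 0.66 → (γ t₀).2.2 < 0 →
          ∀ t ∈ Icc Real.pi t₀, (γ t).2.2 = (γ Real.pi).2.2)) ∧
    -- the first-return map exists and is a generalized attracting horseshoe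
    ∃ P : ℝ × ℝ → ℝ × ℝ, IsPoincareMap P ∧
      MapsTo P Q0 (interior Q0) ∧
      IsGAH P 0.05 1.05 (-0.5) 0.5 0.66 (0.6, 2 / 15) (P '' Q0 ∩ {q | 0.66 ≤ q.1}) ∧
      P '' Q0 = halfTurn '' horseshoeSet 0.44 0.6 0.06 0.26 := by
  have hp := Real.pi_pos
  refine ⟨fun q hq => cartVelocity_ne_zero hq,
    fun q hq => ⟨orbit q, isOrbitFrom_orbit hq, fun δ T hT hδ => hδ.eqOn_orbit hq hT⟩,
    fun q hq γ hγ => ?_, image_half_turn, fun q hq γ hγ t₀ ht₀ => ?_,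
    returnMap, isPoincareMap_returnMap, mapsTo_returnMap, isGAH_returnMap,
    image_returnMap_eq_halfTurn⟩
  · have h := hγ.eqOn_orbit hq le_rfl
    refine ⟨fun t ht => ?_, ?_⟩
    · rw [h ⟨ht.1, by linarith [ht.2]⟩, orbit_of_le q ht.2, stretchCurve]
    · rw [h ⟨hp.le, by linarith⟩, orbit_of_le q le_rfl, stretchCurve_pi]
  · have h : ∀ t ∈ Icc Real.pi (2 * Real.pi), γ t =
        ((foldCurve q.1 (depth q.2) (foldAngle t)).1, t,
          (foldCurve q.1 (depth q.2) (foldAngle t)).2) := fun t ht => by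
      rw [hγ.eqOn_orbit hq le_rfl ⟨hp.le.trans ht.1, ht.2⟩, orbit_of_ge hq ht.1]
    have hc : 0 < depth q.2 := by linarith [(depth_mem hq.2).1]
    rw [h t₀ ht₀]
    refine ⟨fun hD t ht => ?_, fun hr hz t ht => ?_⟩
    · have ht' : t ∈ Icc Real.pi (2 * Real.pi) := ⟨ht₀.1.trans ht.1, ht.2⟩
      rw [h t ht']
      obtain ⟨h1, h2⟩ := foldCurve_rotate hq.1.1 hc
        (strictMonoOn_foldAngle.monotoneOn ht₀ ht' ht.1) hD
      exact ⟨h1, rfl, h2⟩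
    · have hpi : Real.pi ∈ Icc Real.pi (2 * Real.pi) := ⟨le_rfl, by linarith⟩
      have ht' : t ∈ Icc Real.pi (2 * Real.pi) := ⟨ht.1, ht.2.trans ht₀.2⟩
      have key : ∀ s ∈ Icc Real.pi t₀, (foldCurve q.1 (depth q.2) (foldAngle s)).2 =
          -depth q.2 := fun s hs =>
        foldCurve_snd_of_inner hq.1.1 hc
          (strictMonoOn_foldAngle.monotoneOn ⟨hs.1, hs.2.trans ht₀.2⟩ ht₀ hs.2)
          (foldAngle_mem ht₀) hr hz
      rw [h t ht', h _ hpi]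
      exact (key t ht).trans (key _ ⟨le_rfl, ht₀.1⟩).symm
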